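/- **Setting.** Let $\mathcal S,\mathcal U,\mathcal V,\hat{\mathcal S}$ be finite alphabets, $d:\mathcal S\times\hat{\mathcal S}\to[0,\infty)$ a distortion function, and $(S_i,U_i,V_i)_{i\ge 1}$ i.i.d. with pmf $p_{SUV}$. For $D\ge 0$, a pair $(r_{uv},r_v)\in[0,\infty)^2$ is *$D$-admissible* if for each $\varepsilon>0$ there exist arbitrarily large blocklengths $n$ for which, with $M=\lceil 2^{n(r_{uv}+\varepsilon)}\rceil$ and $M'=\lceil 2^{n(r_v+\varepsilon)}\rceil$, there are encoders $E_{uv}:\mathcal S^n\to\{1,\dots,M\}$, $E_v:\mathcal S^n\to\{1,\dots,M'\}$ and decoders $D_u:\{1,\dots,M\}\times\mathcal U^n\to\hat{\mathcal S}^n$, $D_v:\{1,\dots,M\}\times\{1,\dots,M'\}\times\mathcal V^n\to\hat{\mathcal S}^n$ such that the reconstructions $\hat S^n=D_u(E_{uv}(S^n),U^n)$ and $\tilde S^n=D_v(E_{uv}(S^n),E_v(S^n),V^n)$ satisfy $$\frac1n\sum_{i=1}^n\mathbb E[d(S_i,\hat S_i)]\le D+\varepsilon,\qquad \frac1n\sum_{i=1}^n\mathbb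 E[d(S_i,\tilde S_i)]\le D+\varepsilon,\qquad \Pr[\hat S^n\ne\tilde S^n]\le\varepsilon .$$ The $D$-admissible rate region $\mathcal R(D)[p_{SUV}]$ is the set of all $D$-admissible pairs. For $\rho,\delta\in[0,1]$ let $p^{\rho,\delta}_{SUV}$ be the pmf on $\{0,1\}^3$ for which $S$ is equiprobable, $S\to U\to V$ is a Markov chain, and the channels $p_{U|S}$ and $p_{V|U}$ are binary symmetric with crossover probabilities $\rho$ and $\delta$. Take $\hat{\mathcal S}=\{0,1\}$ and $d$ the Hamming distortion. Write $h$ for the binary entropy function in bits and $x\ast y=x(1-y)+y(1-x)$. Limits of sets in $\mathbb R^2$ are taken in the sense of Painlevé–Kuratowski (lower limit and upper limit both equal to the limit set). **Theorem.** Let $0<\rho<D<1/2$ and $L=[\,h(\rho\ast D)-h(D),\infty)\times[0,\infty)$. Then $$\lim_{\delta\downarrow0}\mathcal R(D)[p^{\rho,\delta}_{SUV}]=L\ne\mathcal R(D)[p^{\rho,0}_{SUV}]=[0,\infty)^2,$$ $$\lim_{\delta\uparrow1}\mathcal R(D)[p^{\rho,\delta}_{SUV}]=L\ne\mathcal R(D)[p^{\rho,1}_{SUV}]=[0,\infty)^2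 .$$ Consequently the set-valued map $p_{SUV}\mapsto\mathcal R(D)[p_{SUV}]$ on the simplex of pmfs on $\{0,1\}^3$ is discontinuous at $p^{\rho,0}_{SUV}$ and at $p^{\rho,1}_{SUV}$ (its values do not converge to its value there, in the same sense, as $p_{SUV}$ tends to that point). -/

import Mathlib

open Filter Topology
open scoped NNReal unitInterval

noncomputable section

/-- `(S, U, V)` is drawn from a pmf `p` on a finite alphabet `S × U × V`; the pmfs are the points
of the standard simplex, with its Euclidean topology. -/
abbrev SourcePMF (S U V : Type*) [Fintype S] [Fintype U] [Fintype V] : Type _ :=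
  ↥(stdSimplex ℝ (S × U × V))

/-- Expectation of `f (S₁,U₁,V₁,…,Sₙ,Uₙ,Vₙ)` for the i.i.d. sequence with common pmf `p`. -/
def iidExp {S U V : Type*} [Fintype S] [Fintype U] [Fintype V] (p : SourcePMF S U V) (n : ℕ)
    (f : (Fin n → S × U × V) → ℝ) : ℝ :=
  ∑ ω : Fin n → S × U × V, (∏ i, p.1 (ω i)) * f ω

/-- Probability of an event `E` under the i.i.d. law with common pmf `p`. -/
def iidProb {S U V : Type*} [Fintype S] [Fintype U] [Fintype V] (p : SourcePMF S U V) (n : ℕ)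
    (E : Set (Fin n → S × U × V)) : ℝ :=
  iidExp p n (E.indicator fun _ => 1)

/-- A block code of length `n` with `M` common and `M'` private messages: two encoders, and two
decoders with side information `Uⁿ` and `Vⁿ` respectively. -/
structure CRRCode (S U V R : Type*) (n M M' : ℕ) where
  encUV : (Fin n → S) → Fin M
  encV : (Fin n → S) → Fin M'
  decU : Fin M → (Fin n → U) → (Fin n → R)
  decV : Fin M → Fin M' → (Fin n → V) → (Fin n → R)

namespace CRRCode

variable {S U V R : Type*} {n M M' : ℕ}

/-- The reconstruction of the receiver that sees `Uⁿ` and the common message. -/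
def recU (c : CRRCode S U V R n M M') (ω : Fin n → S × U × V) : Fin n → R :=
  c.decU (c.encUV fun i => (ω i).1) fun i => (ω i).2.1

/-- The reconstruction of the receiver that sees `Vⁿ` and both messages. -/
def recV (c : CRRCode S U V R n M M') (ω : Fin n → S × U × V) : Fin n → R :=
  c.decV (c.encUV fun i => (ω i).1) (c.encV fun i => (ω i).1) fun i => (ω i).2.2

end CRRCode

/-- Number of messages at rate `r` (in bits per symbol) and blocklength `n`: `⌈2 ^ (n r)⌉`. -/
def messageCount (n : ℕ) (r : ℝ) : ℕ := ⌈(2 : ℝ) ^ ((n : ℝ) * r)⌉₊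

/-- `D`-admissibility of a pair `r = (r_uv, r_v)` of rates. The blocklength can be taken as large
as desired. -/
def IsAdmissible {S U V R : Type*} [Fintype S] [Fintype U] [Fintype V]
    (d : S → R → ℝ≥0) (p : SourcePMF S U V) (D : ℝ) (r : ℝ × ℝ) : Prop :=
  0 ≤ r.1 ∧ 0 ≤ r.2 ∧
    ∀ ε : ℝ, 0 < ε → ∀ N : ℕ, ∃ n : ℕ, N ≤ n ∧
      ∃ c : CRRCode S U V R n (messageCount n (r.1 + ε)) (messageCount n (r.2 + ε)),
        (1 / (n : ℝ)) * ∑ i, iidExp p n (fun ω => (d (ω i).1 (c.recU ω i) : ℝ)) ≤ D + ε ∧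
        (1 / (n : ℝ)) * ∑ i, iidExp p n (fun ω => (d (ω i).1 (c.recV ω i) : ℝ)) ≤ D + ε ∧
        iidProb p n {ω | c.recU ω ≠ c.recV ω} ≤ ε

/-- The `D`-admissible rate region of the source `p` with distortion function `d`. -/
def admissibleRegion {S U V R : Type*} [Fintype S] [Fintype U] [Fintype V]
    (d : S → R → ℝ≥0) (D : ℝ) (p : SourcePMF S U V) : Set (ℝ × ℝ) :=
  {r | IsAdmissible d p D r}

/-- Binary Hamming distortion. -/
def hammingDistortion (s t : Fin 2) : ℝ≥0 := if t ≠ s then 1 else 0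

/-- Transition probability `x ↦ y` of the binary symmetric channel with crossover
probability `a`. -/
def bsc (a : ℝ) (x y : Fin 2) : ℝ := if y = x then 1 - a else a

/-- The pmf `p^{ρ,δ}` of `(S, U, V)`: `S` is equiprobable, `S → U → V` is a Markov chain, and the
channels `S → U` and `U → V` are binary symmetric with crossover probabilities `ρ` and `δ`. -/
def binarySource (ρ δ : I) : SourcePMF (Fin 2) (Fin 2) (Fin 2) :=
  ⟨fun x => 1 / 2 * bsc ρ x.1 x.2.1 * bsc δ x.2.1 x.2.2, by
    have h : ∀ (a : I) (x y : Fin 2), 0 ≤ bsc a x y := by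
      intro a x y
      unfold bsc
      split_ifs
      · linarith [a.2.2]
      · exact a.2.1
    refine ⟨fun x => ?_, ?_⟩
    · have h1 := h ρ x.1 x.2.1
      have h2 := h δ x.2.1 x.2.2
      positivity
    · simp [Fintype.sum_prod_type, bsc]
      ring⟩

/-- The region `R(D)[p^{ρ,δ}]` for binary Hamming distortion. -/
def binaryRegion (D : ℝ) (ρ δ : I) : Set (ℝ × ℝ) :=
  admissibleRegion hammingDistortion D (binarySource ρ δ)

/-- Binary entropy function in bits. -/
def binEntropyBits (x : ℝ) : ℝ := Real.binEntropy x / Real.log 2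

/-- Binary convolution `x ∗ y = x (1 - y) + y (1 - x)`. -/
def binConv (x y : ℝ) : ℝ := x * (1 - y) + y * (1 - x)

/-- Lower limit, in the sense of Painlevé and Kuratowski, of a family of sets along a filter. -/
def kuratowskiLiminf {α X : Type*} [TopologicalSpace X] (F : α → Set X) (l : Filter α) : Set X :=
  {x | ∀ W ∈ 𝓝 x, ∀ᶠ a in l, (F a ∩ W).Nonempty}

/-- Upper limit, in the sense of Painlevé and Kuratowski, of a family of sets along a filter. -/
def kuratowskiLimsup {α X : Type*} [TopologicalSpace X] (F : α → Set X) (l : Filter α) : Set X :=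
  {x | ∀ W ∈ 𝓝 x, ∃ᶠ a in l, (F a ∩ W).Nonempty}

/-- The sets `F a` converge to `L` along `l` in the sense of Painlevé and Kuratowski. -/
def SetTendsto {α X : Type*} [TopologicalSpace X] (F : α → Set X) (l : Filter α) (L : Set X) :
    Prop :=
  kuratowskiLiminf F l = L ∧ kuratowskiLimsup F l = L

end

/-!
The endpoint regions are easy. At `δ = 0` both receivers see the same word `Uⁿ`, which differs from
`Sⁿ` in a fraction `ρ < D` of the letters and serves as a common reconstruction at rate zero
(`binaryRegion_zero`); complementing the letters of `Vⁿ` exchanges `δ` and `1 - δ`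
(`binaryRegion_symm`), which settles `δ = 1` and reduces one limit to the other. The limits follow
from two bounds.

*Converse*, for every `0 < δ < 1` (`le_fst_of_mem_binaryRegion`). Given `Sⁿ`, the pair `(Uⁿ, Vⁿ)` is
memoryless and each letter has maximal correlation at most `1 - min δ (1 - δ)`. Maximal correlation
tensorizes, so two reconstructions that agree with probability close to one are close to
deterministic given `Sⁿ`: there is a map `φ` such that the first reconstruction equals `φ (Sⁿ)` with
high probability (`exists_target`). With `q = ρ ∗ D`, the likelihood ratio of `Sⁿ` under crossover
probability `D` to `Uⁿ` under crossover probability `q`, both around `φ (Sⁿ)`, has expectation at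
most the number of common messages on the event that the decoder hits `φ (Sⁿ)`
(`sum_likelihoodRatio_le`). Its mean logarithm is `n` times the tangent at `D` to
`x ↦ h(ρ ∗ x) - h(x)`, evaluated at the mean distortion; the tangent is decreasing with value
`h(q) - h(D)` at `D`. Convexity of the exponential turns this into the bound on the rate
(`exp_mul_le_card_messages`).

*Achievability* (`mem_binaryRegion_of_lt`). A greedy covering code represents every source word by a
codeword `φ (s)` within distance about `n D`, with about `2 ^ (n (1 - h(D)))` codewords
(`exists_coveringCode`). The codewords are distributed at random into bins, and only the bin number
is sent. Seen from `Uⁿ` or `Vⁿ`, the right codeword lies at distance about `n (ρ ∗ D)` or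
`n (ρ ∗ δ ∗ D)`. Both words are uniform, so with more than `2 ^ (n (h(q) - h(D)))` bins, where `q`
exceeds both fractions, no other codeword of the bin is that close, and both receivers recover
`φ (s)`. As `δ → 0`, `q` can be taken arbitrarily close to `ρ ∗ D`.

The regions near the endpoints thus stay away from the origin, which belongs to the endpoint
regions; this is the discontinuity.
-/

/-! ### Block channels and the law of the source -/

lemma bsc_nonneg {a : ℝ} (h0 : 0 ≤ a) (h1 : a ≤ 1) (x y : Fin 2) : 0 ≤ bsc a x y := by
  unfold bsc; split_ifs <;> linarith

lemma bsc_pos {a : ℝ} (h0 : 0 < a) (h1 : a < 1) (x y : Fin 2) : 0 < bsc a x y := by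
  unfold bsc; split_ifs <;> linarith

lemma bsc_le_one {a : ℝ} (h0 : 0 ≤ a) (h1 : a ≤ 1) (x y : Fin 2) : bsc a x y ≤ 1 := by
  unfold bsc; split_ifs <;> linarith

lemma bsc_comm (a : ℝ) (x y : Fin 2) : bsc a x y = bsc a y x := by
  unfold bsc; simp only [eq_comm]

lemma sum_bsc (a : ℝ) (x : Fin 2) : ∑ y, bsc a x y = 1 := by
  fin_cases x <;> simp [bsc]

lemma sum_bsc_mul_bsc (a b : ℝ) (x z : Fin 2) :
    ∑ y, bsc a x y * bsc b y z = bsc (binConv a b) x z := by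
  fin_cases x <;> fin_cases z <;> simp [bsc, binConv] <;> ring

lemma binConv_comm (a b : ℝ) : binConv a b = binConv b a := by
  unfold binConv; ring

lemma binConv_nonneg {a b : ℝ} (ha0 : 0 ≤ a) (ha1 : a ≤ 1) (hb0 : 0 ≤ b) (hb1 : b ≤ 1) :
    0 ≤ binConv a b := by
  unfold binConv
  have := mul_nonneg ha0 (sub_nonneg.2 hb1)
  have := mul_nonneg hb0 (sub_nonneg.2 ha1)
  linarith

/-- The law of the output word given the input word when a word of length `n` is sent through `n`
independent uses of the binary symmetric channel with crossover probability `a`. -/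
noncomputable def blockBsc (a : ℝ) {n : ℕ} (x y : Fin n → Fin 2) : ℝ := ∏ i, bsc a (x i) (y i)

section BlockBsc

variable {n : ℕ}

lemma blockBsc_nonneg {a : ℝ} (h0 : 0 ≤ a) (h1 : a ≤ 1) (x y : Fin n → Fin 2) :
    0 ≤ blockBsc a x y :=
  Finset.prod_nonneg fun _ _ => bsc_nonneg h0 h1 _ _

lemma blockBsc_pos {a : ℝ} (h0 : 0 < a) (h1 : a < 1) (x y : Fin n → Fin 2) :
    0 < blockBsc a x y :=
  Finset.prod_pos fun _ _ => bsc_pos h0 h1 _ _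

lemma blockBsc_comm (a : ℝ) (x y : Fin n → Fin 2) : blockBsc a x y = blockBsc a y x :=
  Finset.prod_congr rfl fun _ _ => bsc_comm _ _ _

lemma sum_blockBsc (a : ℝ) (x : Fin n → Fin 2) : ∑ y, blockBsc a x y = 1 := by
  unfold blockBsc
  rw [← Fintype.prod_sum (fun i c => bsc a (x i) c)]
  exact Finset.prod_eq_one fun i _ => sum_bsc a (x i)

lemma sum_blockBsc_mul_blockBsc (a b : ℝ) (x z : Fin n → Fin 2) :
    ∑ y, blockBsc a x y * blockBsc b y z = blockBsc (binConv a b) x z := by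
  unfold blockBsc
  simp_rw [← Finset.prod_mul_distrib]
  rw [← Fintype.prod_sum (fun i c => bsc a (x i) c * bsc b c (z i))]
  simp_rw [sum_bsc_mul_bsc]

/-- The expectation of a sum of functions of the single letters of the channel output. -/
lemma sum_blockBsc_mul_sum (a : ℝ) (x : Fin n → Fin 2) (f : Fin n → Fin 2 → ℝ) :
    ∑ y, blockBsc a x y * ∑ i, f i (y i) = ∑ i, ∑ c, bsc a (x i) c * f i c := by
  simp_rw [Finset.mul_sum]
  rw [Finset.sum_comm]
  refine Finset.sum_congr rfl fun j _ => ?_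
  have h : ∀ y : Fin n → Fin 2, blockBsc a x y * f j (y j) =
      ∏ i, (bsc a (x i) (y i) * if i = j then f i (y i) else 1) := by
    intro y
    rw [Finset.prod_mul_distrib, Finset.prod_ite_eq' Finset.univ j]
    simp [blockBsc]
  simp_rw [h]
  rw [← Fintype.prod_sum (fun i c => bsc a (x i) c * if i = j then f i c else 1)]
  rw [Finset.prod_eq_single j]
  · simp
  · intro i _ hij
    simpa only [hij, if_false, mul_one] using sum_bsc a (x i)
  · simp

lemma card_words : (Fintype.card (Fin n → Fin 2) : ℝ) = 2 ^ n := by simp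

lemma sum_half_pow_mul_blockBsc (a : ℝ) :
    ∑ s : Fin n → Fin 2, ∑ y : Fin n → Fin 2, (1 / 2) ^ n * blockBsc a s y = 1 := by
  simp_rw [← Finset.mul_sum, sum_blockBsc]
  simp only [Finset.sum_const, Finset.card_univ, Fintype.card_fun, Fintype.card_fin, nsmul_eq_mul]
  push_cast
  rw [mul_one, ← mul_pow]
  norm_num

end BlockBsc

/-- Expectations under the source law `p^{ρ,δ}`, as sums over the three words. -/
lemma iidExp_binarySource (ρ δ : I) (n : ℕ) (f : (Fin n → Fin 2 × Fin 2 × Fin 2) → ℝ) :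
    iidExp (binarySource ρ δ) n f =
      ∑ s : Fin n → Fin 2, ∑ u : Fin n → Fin 2, ∑ v : Fin n → Fin 2,
        (1 / 2) ^ n * blockBsc ρ s u * blockBsc δ u v * f fun i => (s i, u i, v i) := by
  unfold iidExp
  let e : (Fin n → Fin 2 × Fin 2 × Fin 2) ≃
      (Fin n → Fin 2) × (Fin n → Fin 2) × (Fin n → Fin 2) :=
    (Equiv.arrowProdEquivProdArrow _ _ _).trans
      ((Equiv.refl _).prodCongr (Equiv.arrowProdEquivProdArrow _ _ _))
  rw [← e.symm.sum_comp, Fintype.sum_prod_type]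
  refine Finset.sum_congr rfl fun s _ => ?_
  rw [Fintype.sum_prod_type]
  refine Finset.sum_congr rfl fun u _ => Finset.sum_congr rfl fun v _ => ?_
  have : e.symm (s, u, v) = fun i => (s i, u i, v i) := rfl
  rw [this]
  simp only [binarySource, blockBsc, Finset.prod_mul_distrib, Finset.prod_const,
    Finset.card_univ, Fintype.card_fin]

lemma sum_hammingDistortion {n : ℕ} (s t : Fin n → Fin 2) :
    ∑ i, (hammingDistortion (s i) (t i) : ℝ) = hammingDist s t := by
  unfold hammingDist hammingDistortion
  rw [Finset.card_eq_sum_ones, Finset.sum_filter]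
  push_cast
  refine Finset.sum_congr rfl fun i _ => ?_
  by_cases h : s i = t i
  · simp [h]
  · simp [h, Ne.symm h]

lemma hammingDist_le_length {n : ℕ} (s t : Fin n → Fin 2) : (hammingDist s t : ℝ) ≤ n := by
  exact_mod_cast (hammingDist_le_card_fintype (x := s) (y := t)).trans_eq (Fintype.card_fin n)

/-! ### Maximal correlation and agreement -/

/-- A joint law `P` on `X × Y` is correlation bounded by `l` if
`2 Cov(f(X), g(Y)) ≤ l (Var f(X) + Var g(Y))` for all real functions `f` and `g`; up to scaling `f`
and `g`, this says that the maximal correlation of the two coordinates is at most `l`. -/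
def CorrBounded {X Y : Type*} [Fintype X] [Fintype Y] (l : ℝ) (P : X → Y → ℝ) : Prop :=
  ∀ (f : X → ℝ) (g : Y → ℝ),
    2 * (∑ x, ∑ y, P x y * (f x * g y) - (∑ x, ∑ y, P x y * f x) * ∑ x, ∑ y, P x y * g y) ≤
      l * ((∑ x, ∑ y, P x y * f x ^ 2 - (∑ x, ∑ y, P x y * f x) ^ 2) +
        (∑ x, ∑ y, P x y * g y ^ 2 - (∑ x, ∑ y, P x y * g y) ^ 2))

lemma sum_sum_mul_sub_sub_sq {X Y : Type*} [Fintype X] [Fintype Y] (P : X → Y → ℝ) (f : X → ℝ)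
    (g : Y → ℝ) (k : ℝ) :
    ∑ x, ∑ y, P x y * (f x - g y - k) ^ 2 =
      (∑ x, ∑ y, P x y * f x ^ 2) + (∑ x, ∑ y, P x y * g y ^ 2)
        - 2 * (∑ x, ∑ y, P x y * (f x * g y)) - 2 * k * (∑ x, ∑ y, P x y * f x)
        + 2 * k * (∑ x, ∑ y, P x y * g y) + k ^ 2 * ∑ x, ∑ y, P x y := by
  simp only [Finset.mul_sum, ← Finset.sum_add_distrib, ← Finset.sum_sub_distrib]
  refine Finset.sum_congr rfl fun x _ => Finset.sum_congr rfl fun y _ => ?_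
  ring

/-- A joint law that dominates `c` times the product of its marginals has maximal correlation at
most `1 - c`: the variance of `f - g` is at least `c` times what it would be under
independence. -/
lemma corrBounded_of_le {X Y : Type*} [Fintype X] [Fintype Y] {c : ℝ} {P : X → Y → ℝ}
    (hsum : ∑ x, ∑ y, P x y = 1)
    (hP : ∀ x y, c * ((∑ y', P x y') * ∑ x', P x' y) ≤ P x y) : CorrBounded (1 - c) P := by
  intro f g
  set mf := ∑ x, ∑ y, P x y * f x with hmf
  set mg := ∑ x, ∑ y, P x y * g y with hmg
  have hsum' : ∑ y, ∑ x, P x y = 1 := by rw [Finset.sum_comm]; exact hsum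
  have hleft : ∀ a : X → ℝ, ∑ x, ∑ y, (∑ y', P x y') * (∑ x', P x' y) * a x =
      ∑ x, ∑ y, P x y * a x := by
    intro a
    refine Finset.sum_congr rfl fun x _ => ?_
    rw [← Finset.sum_mul, ← Finset.mul_sum, hsum', mul_one, Finset.sum_mul]
  have hright : ∀ b : Y → ℝ, ∑ x, ∑ y, (∑ y', P x y') * (∑ x', P x' y) * b y =
      ∑ x, ∑ y, P x y * b y := by
    intro b
    rw [Finset.sum_comm, Finset.sum_comm (f := fun x y => P x y * b y)]
    refine Finset.sum_congr rfl fun y _ => ?_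
    rw [← Finset.sum_mul, ← Finset.sum_mul, hsum, one_mul, Finset.sum_mul]
  have hprod : ∑ x, ∑ y, (∑ y', P x y') * (∑ x', P x' y) * (f x * g y) = mf * mg := by
    have hg : mg = ∑ y, (∑ x', P x' y) * g y := by
      simp_rw [hmg, Finset.sum_mul]; exact Finset.sum_comm
    have hf : mf = ∑ x, (∑ y', P x y') * f x := by simp_rw [hmf, Finset.sum_mul]
    rw [hf, hg, Finset.sum_mul_sum]
    refine Finset.sum_congr rfl fun x _ => Finset.sum_congr rfl fun y _ => ?_
    ring
  have hone : ∑ x, ∑ y, (∑ y', P x y') * (∑ x', P x' y) = 1 := by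
    simpa [hsum] using hleft fun _ => 1
  have key : c * ∑ x, ∑ y, ((∑ y', P x y') * ∑ x', P x' y) * (f x - g y - (mf - mg)) ^ 2 ≤
      ∑ x, ∑ y, P x y * (f x - g y - (mf - mg)) ^ 2 := by
    simp_rw [Finset.mul_sum, ← mul_assoc]
    refine Finset.sum_le_sum fun x _ => Finset.sum_le_sum fun y _ =>
      mul_le_mul_of_nonneg_right ?_ (sq_nonneg _)
    rw [← Finset.mul_sum]
    exact hP x y
  rw [sum_sum_mul_sub_sub_sq, sum_sum_mul_sub_sub_sq, hleft, hright, hprod, hone, hsum,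
    hleft, hright, ← hmf, ← hmg] at key
  linarith

lemma sum_sum_prodMul {X₁ Y₁ X₂ Y₂ : Type*} [Fintype X₁] [Fintype Y₁] [Fintype X₂] [Fintype Y₂]
    (P₁ : X₁ → Y₁ → ℝ) (P₂ : X₂ → Y₂ → ℝ) (F : X₁ × X₂ → Y₁ × Y₂ → ℝ) :
    ∑ x : X₁ × X₂, ∑ y : Y₁ × Y₂, P₁ x.1 y.1 * P₂ x.2 y.2 * F x y =
      ∑ a, ∑ b, P₁ a b * ∑ x, ∑ y, P₂ x y * F (a, x) (b, y) := by
  simp_rw [Fintype.sum_prod_type, Finset.mul_sum]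
  refine Finset.sum_congr rfl fun a _ => ?_
  rw [Finset.sum_comm]
  refine Finset.sum_congr rfl fun b _ => Finset.sum_congr rfl fun x _ =>
    Finset.sum_congr rfl fun y _ => ?_
  ring

/-- Tensorization: the law of total variance and of total covariance. -/
lemma CorrBounded.prod {X₁ Y₁ X₂ Y₂ : Type*} [Fintype X₁] [Fintype Y₁] [Fintype X₂] [Fintype Y₂]
    {l : ℝ} {P₁ : X₁ → Y₁ → ℝ} {P₂ : X₂ → Y₂ → ℝ} (h₀ : ∀ x y, 0 ≤ P₁ x y)
    (h₁ : CorrBounded l P₁) (h₂ : CorrBounded l P₂) :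
    CorrBounded l fun (x : X₁ × X₂) (y : Y₁ × Y₂) => P₁ x.1 y.1 * P₂ x.2 y.2 := by
  intro f g
  rw [sum_sum_prodMul P₁ P₂ (fun x y => f x * g y), sum_sum_prodMul P₁ P₂ (fun x _ => f x),
    sum_sum_prodMul P₁ P₂ (fun _ y => g y), sum_sum_prodMul P₁ P₂ (fun x _ => f x ^ 2),
    sum_sum_prodMul P₁ P₂ (fun _ y => g y ^ 2)]
  have inner : ∑ a, ∑ b, P₁ a b * (2 * (∑ x, ∑ y, P₂ x y * (f (a, x) * g (b, y)) -
        (∑ x, ∑ y, P₂ x y * f (a, x)) * ∑ x, ∑ y, P₂ x y * g (b, y))) ≤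
      ∑ a, ∑ b, P₁ a b * (l * ((∑ x, ∑ y, P₂ x y * f (a, x) ^ 2 -
        (∑ x, ∑ y, P₂ x y * f (a, x)) ^ 2) + (∑ x, ∑ y, P₂ x y * g (b, y) ^ 2 -
        (∑ x, ∑ y, P₂ x y * g (b, y)) ^ 2))) :=
    Finset.sum_le_sum fun a _ => Finset.sum_le_sum fun b _ =>
      mul_le_mul_of_nonneg_left (h₂ _ _) (h₀ a b)
  have outer := h₁ (fun a => ∑ x, ∑ y, P₂ x y * f (a, x)) fun b => ∑ x, ∑ y, P₂ x y * g (b, y)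
  simp only [mul_sub, mul_add, mul_left_comm _ (2 : ℝ), mul_left_comm _ l,
    Finset.sum_sub_distrib, Finset.sum_add_distrib, ← Finset.mul_sum] at inner outer ⊢
  linarith

/-- Maximal correlation bounds pass to memoryless extensions. -/
lemma CorrBounded.pi {X Y : Type*} [Fintype X] [Fintype Y] {l : ℝ} {n : ℕ}
    {P : Fin n → X → Y → ℝ} (h₀ : ∀ i x y, 0 ≤ P i x y) (h : ∀ i, CorrBounded l (P i)) :
    CorrBounded l fun (x : Fin n → X) (y : Fin n → Y) => ∏ i, P i (x i) (y i) := by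
  induction n with
  | zero =>
    intro f g
    simp
  | succ n ih =>
    intro f g
    have key := CorrBounded.prod (h₀ 0) (h 0) (ih (fun i => h₀ i.succ) fun i => h i.succ)
      (f ∘ Fin.consEquiv fun _ => X) (g ∘ Fin.consEquiv fun _ => Y)
    have conv : ∀ F : (Fin (n + 1) → X) → (Fin (n + 1) → Y) → ℝ,
        ∑ x, ∑ y, (∏ i, P i (x i) (y i)) * F x y =
          ∑ x : X × (Fin n → X), ∑ y : Y × (Fin n → Y),
            (P 0 x.1 y.1 * ∏ i : Fin n, P i.succ (x.2 i) (y.2 i)) *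
              F (Fin.consEquiv (fun _ => X) x) (Fin.consEquiv (fun _ => Y) y) := by
      intro F
      rw [← (Fin.consEquiv fun _ => X).sum_comp]
      refine Finset.sum_congr rfl fun x _ => ?_
      rw [← (Fin.consEquiv fun _ => Y).sum_comp]
      refine Finset.sum_congr rfl fun y _ => ?_
      rw [Fin.prod_univ_succ]
      simp [Fin.consEquiv]
    simp only [Function.comp_apply] at key
    rw [conv fun x y => f x * g y, conv fun x _ => f x, conv fun _ y => g y,
      conv fun x _ => f x ^ 2, conv fun _ y => g y ^ 2]
    exact key

open scoped Classical in
/-- If two correlation-bounded observations `X` and `Y` determine labels `F X` and `G Y` that mostly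
agree, then `F X` is mostly constant. -/
lemma CorrBounded.exists_value {X Y T : Type*} [Fintype X] [Fintype Y] [Fintype T] [Nonempty T]
    {c : ℝ} (hc : c ≤ 1) (hc0 : 0 ≤ c) {P : X → Y → ℝ} (h₀ : ∀ x y, 0 ≤ P x y)
    (hsum : ∑ x, ∑ y, P x y = 1) (h : CorrBounded (1 - c) P) (F : X → T) (G : Y → T) :
    ∃ t, c * ∑ x, ∑ y, P x y * (if F x = t then 0 else 1) ≤
      ∑ x, ∑ y, P x y * (if F x = G y then 0 else 1) := by
  set p : T → ℝ := fun t => ∑ x, ∑ y, P x y * (if F x = t then 1 else 0) with hp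
  set q : T → ℝ := fun t => ∑ x, ∑ y, P x y * (if G y = t then 1 else 0) with hq
  have swap : ∀ K : X → Y → T → ℝ, ∑ t, ∑ x, ∑ y, P x y * K x y t =
      ∑ x, ∑ y, P x y * ∑ t, K x y t := by
    intro K
    rw [Finset.sum_comm]
    refine Finset.sum_congr rfl fun x _ => ?_
    rw [Finset.sum_comm]
    simp_rw [Finset.mul_sum]
  have hp1 : ∑ t, p t = 1 := by
    rw [hp, swap]; simpa using hsum
  have hq1 : ∑ t, q t = 1 := by
    rw [hq, swap]; simpa using hsum
  have hq0 : ∀ t, 0 ≤ q t := fun t => Finset.sum_nonneg fun x _ => Finset.sum_nonneg fun y _ =>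
    mul_nonneg (h₀ x y) (by split_ifs <;> norm_num)
  have hagree : ∑ t, ∑ x, ∑ y, P x y *
      ((if F x = t then (1 : ℝ) else 0) * if G y = t then 1 else 0) =
        1 - ∑ x, ∑ y, P x y * (if F x = G y then 0 else 1) := by
    rw [swap, eq_sub_iff_add_eq]
    refine Eq.trans ?_ hsum
    simp_rw [← Finset.sum_add_distrib]
    refine Finset.sum_congr rfl fun x _ => Finset.sum_congr rfl fun y _ => ?_
    by_cases hxy : F x = G y
    · simp [hxy]
    · simp [hxy]
  -- the value is the most likely label of `X`: its probability is at least `∑ t, p t * q t`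
  obtain ⟨t, ht⟩ : ∃ t, ∀ t', p t' ≤ p t := Finite.exists_max p
  refine ⟨t, ?_⟩
  have hcompl : ∑ x, ∑ y, P x y * (if F x = t then (0 : ℝ) else 1) = 1 - p t := by
    rw [hp, eq_sub_iff_add_eq]
    refine Eq.trans ?_ hsum
    simp_rw [← Finset.sum_add_distrib]
    refine Finset.sum_congr rfl fun x _ => Finset.sum_congr rfl fun y _ => ?_
    split_ifs <;> ring
  have hpoint : ∀ t', ∑ x, ∑ y, P x y *
      ((if F x = t' then (1 : ℝ) else 0) * if G y = t' then 1 else 0) ≤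
        (1 - c) * (p t' + q t') / 2 + c * (p t * q t') := by
    intro t'
    have := h (fun x => if F x = t' then 1 else 0) fun y => if G y = t' then 1 else 0
    simp only [ite_pow, one_pow, ne_eq, OfNat.ofNat_ne_zero, not_false_eq_true, zero_pow] at this
    change 2 * (_ - p t' * q t') ≤ (1 - c) * ((p t' - p t' ^ 2) + (q t' - q t' ^ 2)) at this
    have h2 := mul_le_mul_of_nonneg_left (mul_le_mul_of_nonneg_right (ht t') (hq0 t')) hc0
    have h3 := mul_nonneg (sub_nonneg.2 hc) (sq_nonneg (p t' - q t'))
    nlinarith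
  have htot := Finset.sum_le_sum fun t' (_ : t' ∈ Finset.univ) => hpoint t'
  rw [hagree, Finset.sum_add_distrib, ← Finset.sum_div, ← Finset.mul_sum, ← Finset.mul_sum,
    ← Finset.mul_sum, Finset.sum_add_distrib, hp1, hq1] at htot
  rw [hcompl]
  linarith

/-! ### The converse: a change of measure -/

section Converse

variable {n M : ℕ}

lemma log_blockBsc {a : ℝ} (h0 : 0 < a) (h1 : a < 1) (x y : Fin n → Fin 2) :
    Real.log (blockBsc a x y) = ∑ i, Real.log (bsc a (x i) (y i)) :=
  Real.log_prod fun _ _ => (bsc_pos h0 h1 _ _).ne'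

/-- If the decoder output `dec m u` is to hit a target `φ s` that does not depend on the side
information, then the average over `(s, u)` of the likelihood ratio, restricted to hits, is at most
the number of messages: for each message and each `u` the weights of all `s` with that target sum
to at most the normalizing denominator. -/
lemma sum_likelihoodRatio_le {ρ D : ℝ} (hρ0 : 0 ≤ ρ) (hρ1 : ρ ≤ 1) (hD0 : 0 < D) (hD1 : D < 1)
    (hq0 : 0 < binConv D ρ) (hq1 : binConv D ρ < 1) (enc : (Fin n → Fin 2) → Fin M)
    (dec : Fin M → (Fin n → Fin 2) → (Fin n → Fin 2)) (φ : (Fin n → Fin 2) → (Fin n → Fin 2)) :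
    ∑ s, ∑ u, (1 / 2) ^ n * blockBsc ρ s u *
      ((if dec (enc s) u = φ s then 1 else 0) *
        (blockBsc D (φ s) s / blockBsc (binConv D ρ) (φ s) u)) ≤ M := by
  set q := binConv D ρ
  have term_nonneg : ∀ (s u t : Fin n → Fin 2),
      0 ≤ (1 / 2) ^ n * blockBsc ρ s u * (blockBsc D t s / blockBsc q t u) := fun s u t =>
    mul_nonneg (mul_nonneg (by positivity) (blockBsc_nonneg hρ0 hρ1 _ _))
      (div_nonneg (blockBsc_nonneg hD0.le hD1.le _ _) (blockBsc_nonneg hq0.le hq1.le _ _))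
  have step : ∀ s u, (1 / 2) ^ n * blockBsc ρ s u * ((if dec (enc s) u = φ s then 1 else 0) *
        (blockBsc D (φ s) s / blockBsc q (φ s) u)) ≤
      ∑ m, (1 / 2) ^ n * blockBsc ρ s u * (blockBsc D (dec m u) s / blockBsc q (dec m u) u) := by
    intro s u
    have hsingle := Finset.single_le_sum
      (fun m (_ : m ∈ Finset.univ) => term_nonneg s u (dec m u)) (Finset.mem_univ (enc s))
    split_ifs with h
    · rw [h] at hsingle
      simpa using hsingle
    · rw [zero_mul, mul_zero]
      exact Finset.sum_nonneg fun m _ => term_nonneg s u _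
  have norm : ∀ t u : Fin n → Fin 2,
      ∑ s, (1 / 2) ^ n * blockBsc ρ s u * (blockBsc D t s / blockBsc q t u) = (1 / 2) ^ n := by
    intro t u
    have h1 : ∀ s, (1 / 2) ^ n * blockBsc ρ s u * (blockBsc D t s / blockBsc q t u) =
        (1 / 2) ^ n / blockBsc q t u * (blockBsc D t s * blockBsc ρ s u) := by
      intro s; ring
    simp_rw [h1]
    rw [← Finset.mul_sum, sum_blockBsc_mul_blockBsc]
    exact div_mul_cancel₀ _ (blockBsc_pos hq0 hq1 _ _).ne'
  calc _ ≤ ∑ s, ∑ u, ∑ m, (1 / 2) ^ n * blockBsc ρ s u *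
          (blockBsc D (dec m u) s / blockBsc q (dec m u) u) :=
        Finset.sum_le_sum fun s _ => Finset.sum_le_sum fun u _ => step s u
    _ = ∑ u, ∑ m, ∑ s, (1 / 2) ^ n * blockBsc ρ s u *
          (blockBsc D (dec m u) s / blockBsc q (dec m u) u) := by
        rw [Finset.sum_comm]
        exact Finset.sum_congr rfl fun u _ => Finset.sum_comm
    _ = M := by
        simp_rw [norm]
        simp only [Finset.sum_const, Finset.card_univ, Fintype.card_fun, Fintype.card_fin,
          nsmul_eq_mul]
        push_cast
        rw [mul_left_comm, ← mul_pow]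
        norm_num

/-- The tangent at `D` to the function `x ↦ h(x ∗ ρ) - h(x)` (in nats), evaluated at `x`. -/
noncomputable def rateTangent (ρ D x : ℝ) : ℝ :=
  (Real.log (1 - D) - (1 - ρ) * Real.log (1 - binConv D ρ) - ρ * Real.log (binConv D ρ)) * (1 - x) +
    (Real.log D - (1 - ρ) * Real.log (binConv D ρ) - ρ * Real.log (1 - binConv D ρ)) * x

lemma rateTangent_self (ρ D : ℝ) :
    rateTangent ρ D D = Real.binEntropy (binConv D ρ) - Real.binEntropy D := by
  simp only [rateTangent, Real.binEntropy, Real.log_inv]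
  have : 1 - binConv D ρ = (1 - ρ) * (1 - D) + ρ * D := by unfold binConv; ring
  rw [this]
  have h2 : binConv D ρ = D * (1 - ρ) + ρ * (1 - D) := rfl
  generalize hL : Real.log ((1 - ρ) * (1 - D) + ρ * D) = L
  generalize hL' : Real.log (binConv D ρ) = L'
  rw [h2]
  ring

/-- The mean log-likelihood ratio given `s` is affine in the distance of `s` to the target. -/
lemma sum_blockBsc_mul_logRatio {ρ D : ℝ} (hD0 : 0 < D) (hD1 : D < 1)
    (hq0 : 0 < binConv D ρ) (hq1 : binConv D ρ < 1) (hn : 0 < n) (s t : Fin n → Fin 2) :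
    ∑ u, blockBsc ρ s u * (Real.log (blockBsc D t s) - Real.log (blockBsc (binConv D ρ) t u)) =
      n * rateTangent ρ D (hammingDist s t / n) := by
  have hn' : (n : ℝ) ≠ 0 := by positivity
  simp_rw [log_blockBsc hD0 hD1, log_blockBsc hq0 hq1, ← Finset.sum_sub_distrib]
  rw [sum_blockBsc_mul_sum ρ s fun i c =>
    Real.log (bsc D (t i) (s i)) - Real.log (bsc (binConv D ρ) (t i) c), ← sum_hammingDistortion]
  have letter : ∀ i, ∑ c, bsc ρ (s i) c *
      (Real.log (bsc D (t i) (s i)) - Real.log (bsc (binConv D ρ) (t i) c)) =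
        rateTangent ρ D (hammingDistortion (s i) (t i)) := by
    intro i
    generalize s i = a
    generalize t i = b
    fin_cases a <;> fin_cases b <;> simp [bsc, hammingDistortion, rateTangent] <;> ring
  simp_rw [letter]
  unfold rateTangent
  rw [Finset.sum_add_distrib, ← Finset.mul_sum, ← Finset.mul_sum, Finset.sum_sub_distrib]
  simp only [Finset.sum_const, Finset.card_univ, Fintype.card_fin, nsmul_eq_mul]
  field_simp

lemma le_binConv_and_binConv_le {ρ D : ℝ} (hρ0 : 0 ≤ ρ) (hρ1 : ρ ≤ 1 / 2) (hD1 : D ≤ 1 / 2) :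
    D ≤ binConv D ρ ∧ binConv D ρ ≤ 1 / 2 := by
  unfold binConv
  constructor <;> nlinarith

lemma rateTangent_antitone {ρ D : ℝ} (hρ0 : 0 ≤ ρ) (hρ1 : ρ ≤ 1 / 2) (hD0 : 0 < D)
    (hD1 : D ≤ 1 / 2) : Antitone (rateTangent ρ D) := by
  obtain ⟨hq, hq'⟩ := le_binConv_and_binConv_le hρ0 hρ1 hD1
  set q := binConv D ρ with hqdef
  have h1 : Real.log D ≤ Real.log q := Real.log_le_log hD0 hq
  have h2 : Real.log (1 - q) ≤ Real.log (1 - D) := Real.log_le_log (by linarith) (by linarith)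
  have h3 : Real.log q ≤ Real.log (1 - q) := Real.log_le_log (by linarith) (by linarith)
  intro x y hxy
  unfold rateTangent
  rw [← hqdef]
  nlinarith [mul_nonneg hρ0 (sub_nonneg.2 h3), mul_nonneg (sub_nonneg.2 hxy)
    (add_nonneg (add_nonneg (sub_nonneg.2 h1) (sub_nonneg.2 h2))
      (mul_nonneg (mul_nonneg zero_le_two hρ0) (sub_nonneg.2 h3)))]

/-- A converse for a single receiver: a decoder that observes `u` and hits the target `φ s` except
with probability `e`, where `φ s` has mean distortion at most `x`, needs about
`exp (n · rateTangent ρ D x)` messages. -/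
lemma exp_mul_le_card_messages {ρ D : ℝ} (hρ0 : 0 ≤ ρ) (hρ1 : ρ ≤ 1 / 2) (hD0 : 0 < D)
    (hD1 : D ≤ 1 / 2) (hn : 0 < n) (enc : (Fin n → Fin 2) → Fin M)
    (dec : Fin M → (Fin n → Fin 2) → (Fin n → Fin 2)) (φ : (Fin n → Fin 2) → (Fin n → Fin 2))
    {x e a : ℝ} (hx : ∑ s, (1 / 2) ^ n * (hammingDist s (φ s) : ℝ) ≤ n * x)
    (he : ∑ s, ∑ u, (1 / 2) ^ n * blockBsc ρ s u * (if dec (enc s) u = φ s then 0 else 1) ≤ e)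
    (ha0 : 0 ≤ a) (ha : a ≤ n * (rateTangent ρ D x + Real.log (binConv D ρ) * e)) :
    Real.exp a * (1 - e) ≤ M := by
  obtain ⟨hq, hq'⟩ := le_binConv_and_binConv_le hρ0 hρ1 hD1
  have hM := sum_likelihoodRatio_le hρ0 (by linarith) hD0 (by linarith) (by linarith)
    (by linarith) enc dec φ
  have hanti := rateTangent_antitone hρ0 hρ1 hD0 hD1
  set q := binConv D ρ with hqdef
  have hq0 : 0 < q := by linarith
  have hq1 : q < 1 := by linarith
  set X : (Fin n → Fin 2) → (Fin n → Fin 2) → ℝ := fun s u =>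
    Real.log (blockBsc D (φ s) s) - Real.log (blockBsc q (φ s) u) with hX
  have hW : ∀ s u : Fin n → Fin 2, 0 ≤ (1 / 2) ^ n * blockBsc ρ s u := fun s u =>
    mul_nonneg (by positivity) (blockBsc_nonneg hρ0 (by linarith) _ _)
  have hXle : ∀ s u, X s u ≤ n * -Real.log q := by
    intro s u
    have h1 : Real.log (blockBsc D (φ s) s) ≤ 0 :=
      Real.log_nonpos (blockBsc_nonneg hD0.le (by linarith) _ _)
        (Finset.prod_le_one (fun _ _ => bsc_nonneg hD0.le (by linarith) _ _)
          fun _ _ => bsc_le_one hD0.le (by linarith) _ _)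
    have h2 : n * Real.log q ≤ Real.log (blockBsc q (φ s) u) := by
      rw [log_blockBsc hq0 hq1]
      have : ∑ _i : Fin n, Real.log q ≤ ∑ i, Real.log (bsc q (φ s i) (u i)) := by
        refine Finset.sum_le_sum fun i _ => Real.log_le_log hq0 ?_
        unfold bsc
        split_ifs <;> linarith
      simpa using this
    simp only [hX]
    linarith
  -- on a hit, `exp X ≥ exp a * (1 + X - a)`; on a miss, the right side below is nonpositive
  have point : ∀ s u, Real.exp a * ((1 + X s u - a) -
      (1 + n * -Real.log q) * (if dec (enc s) u = φ s then 0 else 1)) ≤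
      (if dec (enc s) u = φ s then 1 else 0) * (blockBsc D (φ s) s / blockBsc q (φ s) u) := by
    intro s u
    have hexp : Real.exp (X s u) = blockBsc D (φ s) s / blockBsc q (φ s) u := by
      rw [hX]
      simp only
      rw [Real.exp_sub, Real.exp_log (blockBsc_pos hD0 (by linarith) _ _),
        Real.exp_log (blockBsc_pos hq0 hq1 _ _)]
    split_ifs
    · rw [← hexp, mul_zero, sub_zero, one_mul]
      have h1 := Real.add_one_le_exp (X s u - a)
      have h2 : Real.exp (X s u) = Real.exp a * Real.exp (X s u - a) := by
        rw [← Real.exp_add]; congr 1; ring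
      rw [h2]
      exact mul_le_mul_of_nonneg_left (by linarith) (Real.exp_pos a).le
    · rw [zero_mul]
      have := hXle s u
      exact mul_nonpos_of_nonneg_of_nonpos (Real.exp_pos a).le (by linarith)
  have hone := sum_half_pow_mul_blockBsc (n := n) ρ
  have hhalf : ∑ _s : Fin n → Fin 2, (1 / 2 : ℝ) ^ n = 1 := by
    refine Eq.trans ?_ hone
    exact Finset.sum_congr rfl fun s _ => by rw [← Finset.mul_sum, sum_blockBsc, mul_one]
  have hn' : (n : ℝ) ≠ 0 := by positivity
  have hEX : n * rateTangent ρ D x ≤ ∑ s, ∑ u, (1 / 2) ^ n * blockBsc ρ s u * X s u := by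
    have h1 : ∀ s, ∑ u, (1 / 2) ^ n * blockBsc ρ s u * X s u =
        (1 / 2) ^ n * (n * rateTangent ρ D (hammingDist s (φ s) / n)) := by
      intro s
      rw [← sum_blockBsc_mul_logRatio hD0 (by linarith) hq0 hq1 hn, Finset.mul_sum]
      exact Finset.sum_congr rfl fun u _ => by rw [mul_assoc]
    simp_rw [h1]
    have h2 : ∑ s, (1 / 2 : ℝ) ^ n * (n * rateTangent ρ D (hammingDist s (φ s) / n)) =
        n * rateTangent ρ D ((∑ s, (1 / 2) ^ n * (hammingDist s (φ s) : ℝ)) / n) := by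
      unfold rateTangent
      generalize Real.log (1 - D) - (1 - ρ) * Real.log (1 - binConv D ρ) -
        ρ * Real.log (binConv D ρ) = A
      generalize Real.log D - (1 - ρ) * Real.log (binConv D ρ) -
        ρ * Real.log (1 - binConv D ρ) = B
      have h3 : ∀ s, (1 / 2 : ℝ) ^ n * (n * (A * (1 - hammingDist s (φ s) / n) +
          B * (hammingDist s (φ s) / n))) =
          n * A * (1 / 2) ^ n + (B - A) * ((1 / 2) ^ n * hammingDist s (φ s)) := by
        intro s
        field_simp
        ring
      simp_rw [h3]
      rw [Finset.sum_add_distrib, ← Finset.mul_sum, ← Finset.mul_sum, hhalf]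
      field_simp
      ring
    rw [h2]
    refine mul_le_mul_of_nonneg_left (hanti ?_) (by positivity)
    rw [div_le_iff₀ (by positivity)]
    linarith
  have htot : ∑ s, ∑ u, (1 / 2) ^ n * blockBsc ρ s u * (Real.exp a * ((1 + X s u - a) -
      (1 + n * -Real.log q) * (if dec (enc s) u = φ s then 0 else 1))) ≤ M :=
    le_trans (Finset.sum_le_sum fun s _ => Finset.sum_le_sum fun u _ =>
      mul_le_mul_of_nonneg_left (point s u) (hW s u)) hM
  have hsplit : ∑ s, ∑ u, (1 / 2) ^ n * blockBsc ρ s u * (Real.exp a * ((1 + X s u - a) -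
      (1 + n * -Real.log q) * (if dec (enc s) u = φ s then 0 else 1))) =
      Real.exp a * ((1 - a) * ∑ s : Fin n → Fin 2, ∑ u : Fin n → Fin 2, (1 / 2) ^ n * blockBsc ρ s u
        + ∑ s, ∑ u, (1 / 2) ^ n * blockBsc ρ s u * X s u
        - (1 + n * -Real.log q) * ∑ s, ∑ u, (1 / 2) ^ n * blockBsc ρ s u *
          (if dec (enc s) u = φ s then 0 else 1)) := by
    simp only [Finset.mul_sum, ← Finset.sum_add_distrib, ← Finset.sum_sub_distrib]
    refine Finset.sum_congr rfl fun s _ => Finset.sum_congr rfl fun u _ => ?_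
    ring
  rw [hsplit, hone] at htot
  refine le_trans (mul_le_mul_of_nonneg_left ?_ (Real.exp_pos a).le) htot
  have hlog : Real.log q ≤ 0 := Real.log_nonpos hq0.le hq1.le
  have hcoef : 0 ≤ 1 + n * -Real.log q := by
    have := mul_nonneg (Nat.cast_nonneg (α := ℝ) n) (neg_nonneg.2 hlog)
    linarith
  have := mul_le_mul_of_nonneg_left he hcoef
  nlinarith

end Converse

/-! ### The converse: common reconstructions and the rate region -/

lemma sum_sum_sum_blockBsc (ρ δ : ℝ) {n : ℕ} (F : (Fin n → Fin 2) → (Fin n → Fin 2) → ℝ) :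
    ∑ s : Fin n → Fin 2, ∑ u : Fin n → Fin 2, ∑ v : Fin n → Fin 2,
        (1 / 2) ^ n * blockBsc ρ s u * blockBsc δ u v * F s u =
      ∑ s, ∑ u, (1 / 2) ^ n * blockBsc ρ s u * F s u := by
  refine Finset.sum_congr rfl fun s _ => Finset.sum_congr rfl fun u _ => ?_
  rw [← Finset.sum_mul, ← Finset.mul_sum, sum_blockBsc, mul_one]

/-- Given the source word, the pair of side informations has maximal correlation at most
`1 - min δ (1 - δ)`, whatever the blocklength. -/
lemma corrBounded_sideInformation {ρ δ : ℝ} (hρ0 : 0 ≤ ρ) (hρ1 : ρ ≤ 1) (hδ0 : 0 ≤ δ)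
    (hδ1 : δ ≤ 1) {n : ℕ} (s : Fin n → Fin 2) :
    CorrBounded (1 - min δ (1 - δ)) fun u v => blockBsc ρ s u * blockBsc δ u v := by
  have h := CorrBounded.pi (n := n) (l := 1 - min δ (1 - δ))
    (P := fun i (a b : Fin 2) => bsc ρ (s i) a * bsc δ a b)
    (fun i x y => mul_nonneg (bsc_nonneg hρ0 hρ1 _ _) (bsc_nonneg hδ0 hδ1 _ _)) fun i => by
      refine corrBounded_of_le ?_ fun x y => ?_
      · simp_rw [← Finset.mul_sum, sum_bsc, mul_one]
        exact sum_bsc _ _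
      · simp_rw [← Finset.mul_sum, sum_bsc, mul_one]
        have h1 : min δ (1 - δ) ≤ bsc δ x y := by
          unfold bsc
          split_ifs
          · exact min_le_right _ _
          · exact min_le_left _ _
        have h0 : 0 ≤ min δ (1 - δ) := le_min hδ0 (by linarith)
        have h2 : ∑ a, bsc ρ (s i) a * bsc δ a y ≤ 1 := by
          rw [← sum_bsc ρ (s i)]
          exact Finset.sum_le_sum fun a _ =>
            mul_le_of_le_one_right (bsc_nonneg hρ0 hρ1 _ _) (bsc_le_one hδ0 hδ1 _ _)
        have h3 := bsc_nonneg hρ0 hρ1 (s i) x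
        calc min δ (1 - δ) * (bsc ρ (s i) x * ∑ a, bsc ρ (s i) a * bsc δ a y)
            ≤ min δ (1 - δ) * (bsc ρ (s i) x * 1) :=
              mul_le_mul_of_nonneg_left (mul_le_mul_of_nonneg_left h2 h3) h0
          _ ≤ bsc ρ (s i) x * bsc δ x y := by
              rw [mul_one, mul_comm]
              exact mul_le_mul_of_nonneg_left h1 h3
  simpa only [Finset.prod_mul_distrib, blockBsc] using h

/-- A target for the reconstructions that depends on the source word only: if the two
reconstructions mostly agree, then the first one mostly equals the target. -/
lemma exists_target (ρ δ : I) {n M M' : ℕ} (c : CRRCode (Fin 2) (Fin 2) (Fin 2) (Fin 2) n M M') :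
    ∃ φ : (Fin n → Fin 2) → (Fin n → Fin 2),
      min (δ : ℝ) (1 - δ) * ∑ s, ∑ u, (1 / 2) ^ n * blockBsc ρ s u *
          (if c.decU (c.encUV s) u = φ s then 0 else 1) ≤
        iidProb (binarySource ρ δ) n {ω | c.recU ω ≠ c.recV ω} := by
  have hc0 : (0 : ℝ) ≤ min (δ : ℝ) (1 - δ) := le_min δ.2.1 (by linarith [δ.2.2])
  have hc1 : min (δ : ℝ) (1 - δ) ≤ 1 := (min_le_left _ _).trans δ.2.2
  have hex := fun s : Fin n → Fin 2 =>
    (corrBounded_sideInformation ρ.2.1 ρ.2.2 δ.2.1 δ.2.2 s).exists_value hc1 hc0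
      (fun u v => mul_nonneg (blockBsc_nonneg ρ.2.1 ρ.2.2 _ _) (blockBsc_nonneg δ.2.1 δ.2.2 _ _))
      (by simp_rw [← Finset.mul_sum, sum_blockBsc, mul_one]; exact sum_blockBsc _ _)
      (c.decU (c.encUV s)) (c.decV (c.encUV s) (c.encV s))
  choose φ hφ using hex
  refine ⟨φ, ?_⟩
  rw [iidProb, iidExp_binarySource, ← sum_sum_sum_blockBsc ρ δ, Finset.mul_sum]
  refine Finset.sum_le_sum fun s _ => ?_
  have := mul_le_mul_of_nonneg_left (hφ s) (by positivity : (0 : ℝ) ≤ (1 / 2) ^ n)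
  rw [mul_left_comm] at this
  simp only [Finset.mul_sum] at this ⊢
  refine (this.trans_eq' ?_).trans_eq ?_ <;>
    refine Finset.sum_congr rfl fun u _ => Finset.sum_congr rfl fun v _ => ?_
  · split_ifs <;> ring
  · rw [Set.indicator_apply]
    change _ = _ * if c.decU (c.encUV s) u ≠ c.decV (c.encUV s) (c.encV s) v then _ else _
    by_cases h : c.decU (c.encUV s) u = c.decV (c.encUV s) (c.encV s) v
    · simp [h]
    · simp [h, mul_assoc]

lemma iidExp_sum {S U V : Type*} [Fintype S] [Fintype U] [Fintype V] (p : SourcePMF S U V) (n : ℕ)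
    {ι : Type*} (t : Finset ι) (f : ι → (Fin n → S × U × V) → ℝ) :
    ∑ i ∈ t, iidExp p n (f i) = iidExp p n fun ω => ∑ i ∈ t, f i ω := by
  unfold iidExp
  rw [Finset.sum_comm]
  simp_rw [Finset.mul_sum]

lemma two_rpow_eq_exp (x : ℝ) : (2 : ℝ) ^ x = Real.exp (x * Real.log 2) := by
  rw [Real.rpow_def_of_pos two_pos, mul_comm]

/-- No pair with a smaller common rate is admissible when neither of the two side informations
determines the other. As the agreement error `ε` tends to zero, so does the probability `ε / k` that
the first reconstruction misses its target. -/
lemma le_fst_of_mem_binaryRegion {ρ δ : I} {D : ℝ} (hρ0 : (0 : ℝ) < ρ) (hρ1 : (ρ : ℝ) ≤ 1 / 2)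
    (hδ0 : (0 : ℝ) < δ) (hδ1 : (δ : ℝ) < 1) (hD0 : 0 < D) (hD1 : D < 1 / 2) {r : ℝ × ℝ}
    (hr : r ∈ binaryRegion D ρ δ) :
    binEntropyBits (binConv ρ D) - binEntropyBits D ≤ r.1 := by
  obtain ⟨hr1, -, hadm⟩ := hr
  obtain ⟨hq, hq'⟩ := le_binConv_and_binConv_le hρ0.le hρ1 hD1.le
  have hlt : D < binConv D ρ := by unfold binConv; nlinarith
  have hlog2 : 0 < Real.log 2 := Real.log_pos one_lt_two
  have hG : 0 < rateTangent ρ D D := by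
    rw [rateTangent_self, sub_pos]
    exact Real.binEntropy_strictMonoOn ⟨hD0.le, by linarith⟩ ⟨by linarith, by linarith⟩ hlt
  rw [binConv_comm, binEntropyBits, binEntropyBits, ← sub_div, ← rateTangent_self,
    div_le_iff₀ hlog2]
  by_contra! hcon
  -- below, `ε` is so small that the lower bound on `log M` exceeds `log` of the message count
  set k : ℝ := min (δ : ℝ) (1 - δ) with hk
  have hk0 : 0 < k := lt_min hδ0 (by linarith)
  have hcont : Continuous fun ε : ℝ => rateTangent ρ D (D + ε + ε / k) +
      Real.log (binConv D ρ) * (ε / k) := by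
    unfold rateTangent; fun_prop
  have hcont2 : Continuous fun ε : ℝ => Real.log 4 * ε + (r.1 + ε) * Real.log 2 := by fun_prop
  have ev1 : ∀ᶠ ε : ℝ in 𝓝[>] 0, 0 < rateTangent ρ D (D + ε + ε / k) +
      Real.log (binConv D ρ) * (ε / k) := by
    refine (hcont.tendsto' 0 _ rfl).mono_left nhdsWithin_le_nhds |>.eventually_const_lt ?_
    simpa using hG
  have ev2 : ∀ᶠ ε : ℝ in 𝓝[>] 0, Real.log 4 * ε + (r.1 + ε) * Real.log 2 <
      rateTangent ρ D (D + ε + ε / k) + Real.log (binConv D ρ) * (ε / k) := by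
    refine ((hcont2.tendsto' 0 _ rfl).mono_left nhdsWithin_le_nhds).eventually_lt
      ((hcont.tendsto' 0 _ rfl).mono_left nhdsWithin_le_nhds) ?_
    simpa using hcon
  have ev3 : ∀ᶠ ε : ℝ in 𝓝[>] 0, ε / k < 1 / 2 := by
    refine ((continuous_id.div_const k).tendsto' 0 0 (by simp)).mono_left
      nhdsWithin_le_nhds |>.eventually_lt_const (by norm_num)
  obtain ⟨ε, ⟨⟨h1, h2⟩, h3⟩, hε⟩ := (((ev1.and ev2).and ev3).and self_mem_nhdsWithin).exists
  replace hε : 0 < ε := hε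
  obtain ⟨n, hn, c, hc1, -, hc3⟩ := hadm ε hε (⌈1 / ε⌉₊)
  have hnε : 1 ≤ n * ε := by
    rw [← div_le_iff₀ hε]
    exact (Nat.le_ceil _).trans (by exact_mod_cast hn)
  have hn0 : 0 < n := by
    rcases Nat.eq_zero_or_pos n with h | h
    · rw [h] at hnε; norm_num at hnε
    · exact h
  have hnpos : (0 : ℝ) < n := by exact_mod_cast hn0
  obtain ⟨φ, hφ⟩ := exists_target ρ δ c
  set e := ∑ s, ∑ u, (1 / 2) ^ n * blockBsc (ρ : ℝ) s u *
    (if c.decU (c.encUV s) u = φ s then (0 : ℝ) else 1) with he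
  have hek : e ≤ ε / k := by
    rw [le_div_iff₀ hk0, mul_comm]
    exact hφ.trans hc3
  have hdist : ∑ s, (1 / 2) ^ n * (hammingDist s (φ s) : ℝ) ≤ n * (D + ε + ε / k) := by
    have hd : ∑ s, ∑ u, (1 / 2) ^ n * blockBsc (ρ : ℝ) s u *
        (hammingDist s (c.decU (c.encUV s) u) : ℝ) ≤ n * (D + ε) := by
      rw [iidExp_sum, iidExp_binarySource, one_div_mul_eq_div, div_le_iff₀ hnpos, mul_comm] at hc1
      rw [← sum_sum_sum_blockBsc ρ δ]
      refine le_trans (le_of_eq ?_) hc1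
      refine Finset.sum_congr rfl fun s _ => Finset.sum_congr rfl fun u _ =>
        Finset.sum_congr rfl fun v _ => ?_
      congr 1
      exact (sum_hammingDistortion s (c.decU (c.encUV s) u)).symm
    have hs : ∑ s, (1 / 2) ^ n * (hammingDist s (φ s) : ℝ) =
        ∑ s, ∑ u, (1 / 2) ^ n * blockBsc (ρ : ℝ) s u * (hammingDist s (φ s) : ℝ) := by
      refine Finset.sum_congr rfl fun s _ => ?_
      rw [← Finset.sum_mul, ← Finset.mul_sum, sum_blockBsc, mul_one]
    have hpt : ∑ s, ∑ u, (1 / 2) ^ n * blockBsc (ρ : ℝ) s u * (hammingDist s (φ s) : ℝ) ≤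
        ∑ s, ∑ u, (1 / 2) ^ n * blockBsc (ρ : ℝ) s u *
          (hammingDist s (c.decU (c.encUV s) u) : ℝ) + n * e := by
      rw [he]
      simp only [Finset.mul_sum, ← Finset.sum_add_distrib]
      refine Finset.sum_le_sum fun s _ => Finset.sum_le_sum fun u _ => ?_
      have hw : 0 ≤ (1 / 2) ^ n * blockBsc (ρ : ℝ) s u :=
        mul_nonneg (by positivity) (blockBsc_nonneg ρ.2.1 ρ.2.2 _ _)
      split_ifs with h
      · rw [h]; simp
      · rw [mul_one, mul_comm (n : ℝ), ← mul_add]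
        refine mul_le_mul_of_nonneg_left ?_ hw
        have := hammingDist_le_length s (φ s)
        have h0 : (0 : ℝ) ≤ hammingDist s (c.decU (c.encUV s) u) := by positivity
        linarith
    rw [hs]
    nlinarith [mul_le_mul_of_nonneg_left hek hnpos.le]
  have hM := exp_mul_le_card_messages hρ0.le hρ1 hD0 hD1.le hn0 c.encUV c.decU φ hdist hek
    (mul_nonneg hnpos.le h1.le) le_rfl
  set a := n * (rateTangent ρ D (D + ε + ε / k) + Real.log (binConv D ρ) * (ε / k)) with ha
  have hcard : (messageCount n (r.1 + ε) : ℝ) ≤ 2 * Real.exp (n * (r.1 + ε) * Real.log 2) := by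
    have h4 := (Nat.ceil_lt_add_one (Real.exp_pos (n * (r.1 + ε) * Real.log 2)).le).le
    have h5 : (1 : ℝ) ≤ Real.exp (n * (r.1 + ε) * Real.log 2) :=
      Real.one_le_exp (by positivity)
    unfold messageCount
    rw [two_rpow_eq_exp]
    linarith
  have hexp : Real.exp a ≤ Real.exp (Real.log 4 + n * (r.1 + ε) * Real.log 2) := by
    rw [Real.exp_add, Real.exp_log (by norm_num)]
    have := Real.exp_pos a
    nlinarith
  rw [Real.exp_le_exp] at hexp
  have h5 : Real.log 4 ≤ Real.log 4 * (n * ε) :=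
    le_mul_of_one_le_right (Real.log_nonneg (by norm_num)) hnε
  have h6 := mul_lt_mul_of_pos_left h2 hnpos
  rw [← ha] at h6
  nlinarith

/-! ### Concentration and ball volumes -/

section Volume

variable {n : ℕ}

/-- A Chernoff bound for sums of functions, bounded by one in absolute value, of the letters of the
output of a block channel. -/
lemma sum_blockBsc_tail_le {a : ℝ} (h0 : 0 ≤ a) (h1 : a ≤ 1) (x : Fin n → Fin 2)
    (f : Fin n → Fin 2 → ℝ) (hf : ∀ i c, |f i c| ≤ 1) {m γ : ℝ} (hγ0 : 0 ≤ γ) (hγ1 : γ ≤ 1)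
    (hm : ∑ i, ∑ c, bsc a (x i) c * f i c ≤ m) :
    ∑ y, blockBsc a x y * (if m + n * γ ≤ ∑ i, f i (y i) then 1 else 0) ≤
      Real.exp (-(n * (γ ^ 2 / 4))) := by
  have hpt : ∀ y : Fin n → Fin 2, blockBsc a x y * (if m + n * γ ≤ ∑ i, f i (y i) then 1 else 0) ≤
      Real.exp (-(γ / 2 * (m + n * γ))) *
        ∏ i, (bsc a (x i) (y i) * Real.exp (γ / 2 * f i (y i))) := by
    intro y
    rw [Finset.prod_mul_distrib, ← Real.exp_sum, ← Finset.mul_sum, mul_left_comm, ← Real.exp_add]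
    refine mul_le_mul_of_nonneg_left ?_ (blockBsc_nonneg h0 h1 x y)
    split_ifs with h
    · refine Real.one_le_exp ?_
      have := mul_le_mul_of_nonneg_left h (by linarith : 0 ≤ γ / 2)
      linarith
    · exact (Real.exp_pos _).le
  have hletter : ∀ i, ∑ c, bsc a (x i) c * Real.exp (γ / 2 * f i c) ≤
      Real.exp (γ / 2 * ∑ c, bsc a (x i) c * f i c + γ ^ 2 / 4) := by
    intro i
    have h2 : ∀ c, Real.exp (γ / 2 * f i c) ≤ 1 + γ / 2 * f i c + γ ^ 2 / 4 := by
      intro c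
      have habs : |γ / 2 * f i c| ≤ γ / 2 := by
        rw [abs_mul, abs_of_nonneg (by linarith : 0 ≤ γ / 2)]
        exact mul_le_of_le_one_right (by linarith) (hf i c)
      have h3 := (abs_le.1 (Real.abs_exp_sub_one_sub_id_le (habs.trans (by linarith)))).2
      have h4 : (γ / 2 * f i c) ^ 2 ≤ (γ / 2) ^ 2 := by
        rw [← sq_abs]
        exact pow_le_pow_left₀ (abs_nonneg _) habs 2
      linarith
    calc ∑ c, bsc a (x i) c * Real.exp (γ / 2 * f i c)
        ≤ ∑ c, bsc a (x i) c * (1 + γ / 2 * f i c + γ ^ 2 / 4) :=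
          Finset.sum_le_sum fun c _ => mul_le_mul_of_nonneg_left (h2 c) (bsc_nonneg h0 h1 _ _)
      _ = γ / 2 * ∑ c, bsc a (x i) c * f i c + γ ^ 2 / 4 + 1 := by
          have h5 : ∀ c, bsc a (x i) c * (1 + γ / 2 * f i c + γ ^ 2 / 4) =
            bsc a (x i) c * (1 + γ ^ 2 / 4) + γ / 2 * (bsc a (x i) c * f i c) := by
            intro c; ring
          simp_rw [h5]
          rw [Finset.sum_add_distrib, ← Finset.sum_mul, ← Finset.mul_sum, sum_bsc]
          ring
      _ ≤ _ := Real.add_one_le_exp _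
  calc _ ≤ ∑ y : Fin n → Fin 2, Real.exp (-(γ / 2 * (m + n * γ))) *
        ∏ i, (bsc a (x i) (y i) * Real.exp (γ / 2 * f i (y i))) :=
        Finset.sum_le_sum fun y _ => hpt y
    _ = Real.exp (-(γ / 2 * (m + n * γ))) *
        ∏ i, ∑ c, bsc a (x i) c * Real.exp (γ / 2 * f i c) := by
        rw [← Finset.mul_sum, Fintype.prod_sum fun i c => bsc a (x i) c * Real.exp (γ / 2 * f i c)]
    _ ≤ Real.exp (-(γ / 2 * (m + n * γ))) *
        ∏ i, Real.exp (γ / 2 * ∑ c, bsc a (x i) c * f i c + γ ^ 2 / 4) :=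
        mul_le_mul_of_nonneg_left (Finset.prod_le_prod
          (fun i _ => Finset.sum_nonneg fun c _ =>
            mul_nonneg (bsc_nonneg h0 h1 _ _) (Real.exp_pos _).le) fun i _ => hletter i)
          (Real.exp_pos _).le
    _ ≤ _ := by
        rw [← Real.exp_sum, ← Real.exp_add, Finset.sum_add_distrib, ← Finset.mul_sum]
        refine Real.exp_le_exp.2 ?_
        have := mul_le_mul_of_nonneg_left hm (by linarith : 0 ≤ γ / 2)
        simp only [Finset.sum_const, Finset.card_univ, Fintype.card_fin, nsmul_eq_mul]
        nlinarith

lemma sum_bsc_mul_hammingDistortion (a : ℝ) (x t : Fin 2) :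
    ∑ c, bsc a x c * (hammingDistortion c t : ℝ) = a + (1 - 2 * a) * hammingDistortion x t := by
  fin_cases x <;> fin_cases t <;> simp [bsc, hammingDistortion] <;> ring

lemma abs_hammingDistortion_le (x t : Fin 2) : |(hammingDistortion x t : ℝ)| ≤ 1 := by
  unfold hammingDistortion
  split_ifs <;> simp

/-- If `t` is within distance `n D` of the channel input, then it is unlikely to be at distance
`n (a ∗ D + γ)` or more of the channel output. -/
lemma sum_blockBsc_far_le {a D : ℝ} (h0 : 0 ≤ a) (h1 : a ≤ 1 / 2) {x t : Fin n → Fin 2}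
    (hx : (hammingDist x t : ℝ) ≤ n * D) {γ : ℝ} (hγ0 : 0 ≤ γ) (hγ1 : γ ≤ 1) :
    ∑ y, blockBsc a x y * (if n * (binConv a D + γ) ≤ (hammingDist y t : ℝ) then 1 else 0) ≤
      Real.exp (-(n * (γ ^ 2 / 4))) := by
  have hmean : ∑ i, ∑ c, bsc a (x i) c * (hammingDistortion c (t i) : ℝ) ≤ n * binConv a D := by
    simp_rw [sum_bsc_mul_hammingDistortion]
    rw [Finset.sum_add_distrib, ← Finset.mul_sum, sum_hammingDistortion]
    simp only [Finset.sum_const, Finset.card_univ, Fintype.card_fin, nsmul_eq_mul]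
    have := mul_le_mul_of_nonneg_left hx (by linarith : 0 ≤ 1 - 2 * a)
    unfold binConv
    linarith
  have := sum_blockBsc_tail_le h0 (by linarith) x (fun i c => (hammingDistortion c (t i) : ℝ))
    (fun i c => abs_hammingDistortion_le _ _) hγ0 hγ1 hmean
  simp_rw [sum_hammingDistortion] at this
  rw [mul_add]
  exact this

lemma log_blockBsc_eq {a : ℝ} (h0 : 0 < a) (h1 : a < 1) (x y : Fin n → Fin 2) :
    Real.log (blockBsc a x y) =
      n * Real.log (1 - a) - hammingDist y x * (Real.log (1 - a) - Real.log a) := by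
  rw [log_blockBsc h0 h1, ← sum_hammingDistortion, Finset.sum_mul]
  have : (n : ℝ) * Real.log (1 - a) = ∑ _i : Fin n, Real.log (1 - a) := by simp
  rw [this, ← Finset.sum_sub_distrib]
  refine Finset.sum_congr rfl fun i _ => ?_
  unfold bsc hammingDistortion
  by_cases h : y i = x i
  · simp [h]
  · simp [h, Ne.symm h]

lemma binEntropy_eq_log (a : ℝ) :
    Real.binEntropy a = -Real.log (1 - a) + a * (Real.log (1 - a) - Real.log a) := by
  simp only [Real.binEntropy, Real.log_inv]
  ring

/-- The volume of a Hamming ball of radius `n q` is at most `exp (n h(q))`. -/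
lemma card_ball_le {q : ℝ} (h0 : 0 < q) (h1 : q ≤ 1 / 2) (t : Fin n → Fin 2) :
    ∑ y : Fin n → Fin 2, (if (hammingDist y t : ℝ) ≤ n * q then (1 : ℝ) else 0) ≤
      Real.exp (n * Real.binEntropy q) := by
  have hκ : 0 ≤ Real.log (1 - q) - Real.log q :=
    sub_nonneg.2 (Real.log_le_log h0 (by linarith))
  have hpt : ∀ y : Fin n → Fin 2, (if (hammingDist y t : ℝ) ≤ n * q then (1 : ℝ) else 0) ≤
      Real.exp (n * Real.binEntropy q) * blockBsc q t y := by
    intro y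
    have hpos := blockBsc_pos h0 (by linarith) t y
    split_ifs with h
    · rw [← Real.exp_log hpos, ← Real.exp_add, log_blockBsc_eq h0 (by linarith), binEntropy_eq_log]
      refine Real.one_le_exp ?_
      have := mul_le_mul_of_nonneg_right h hκ
      linarith
    · positivity
  refine (Finset.sum_le_sum fun y _ => hpt y).trans_eq ?_
  rw [← Finset.mul_sum, sum_blockBsc, mul_one]

/-- A lower bound for the volume of a Hamming ball of radius `n (D + γ)`: under the product law with
flip probability `D` around the center, the shell `n (D - γ) < d < n (D + γ)` has probability close
to one, and each of its points has small probability. -/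
lemma le_card_ball {D γ : ℝ} (h0 : 0 < D) (h1 : D ≤ 1 / 2) (hγ0 : 0 ≤ γ) (hγ1 : γ ≤ 1)
    (t : Fin n → Fin 2) :
    (1 - 2 * Real.exp (-(n * (γ ^ 2 / 4)))) *
        Real.exp (n * (Real.binEntropy D - γ * (Real.log (1 - D) - Real.log D))) ≤
      ∑ y : Fin n → Fin 2, (if (hammingDist y t : ℝ) ≤ n * (D + γ) then (1 : ℝ) else 0) := by
  have hκ : 0 ≤ Real.log (1 - D) - Real.log D :=
    sub_nonneg.2 (Real.log_le_log h0 (by linarith))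
  set E := Real.exp (n * (Real.binEntropy D - γ * (Real.log (1 - D) - Real.log D))) with hE
  have hmean : ∑ i, ∑ c, bsc D (t i) c * (hammingDistortion c (t i) : ℝ) = n * D := by
    simp_rw [sum_bsc_mul_hammingDistortion]
    simp [hammingDistortion]
  have hup := sum_blockBsc_tail_le h0.le (by linarith) t
    (fun i c => (hammingDistortion c (t i) : ℝ)) (fun i c => abs_hammingDistortion_le _ _) hγ0 hγ1
    hmean.le
  have hlow := sum_blockBsc_tail_le h0.le (by linarith) t
    (fun i c => -(hammingDistortion c (t i) : ℝ))
    (fun i c => by rw [abs_neg]; exact abs_hammingDistortion_le _ _) hγ0 hγ1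
    (m := -(n * D)) (by simp_rw [mul_neg, Finset.sum_neg_distrib]; rw [hmean])
  simp_rw [Finset.sum_neg_distrib] at hlow
  simp_rw [sum_hammingDistortion] at hup hlow
  have hpt : ∀ y : Fin n → Fin 2,
      E * (blockBsc D t y
        - blockBsc D t y * (if n * D + n * γ ≤ (hammingDist y t : ℝ) then 1 else 0)
        - blockBsc D t y * (if -(n * D) + n * γ ≤ -(hammingDist y t : ℝ) then 1 else 0)) ≤
      if (hammingDist y t : ℝ) ≤ n * (D + γ) then (1 : ℝ) else 0 := by
    intro y
    have hpos := blockBsc_pos h0 (by linarith) t y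
    have hEpos := Real.exp_pos (n * (Real.binEntropy D - γ * (Real.log (1 - D) - Real.log D)))
    by_cases ha : n * D + n * γ ≤ (hammingDist y t : ℝ)
    · refine (mul_nonpos_of_nonneg_of_nonpos hEpos.le ?_).trans (by split_ifs <;> norm_num)
      rw [if_pos ha]
      have : 0 ≤ blockBsc D t y *
        (if -(n * D) + n * γ ≤ -(hammingDist y t : ℝ) then (1 : ℝ) else 0) := by
        split_ifs <;> simp [hpos.le]
      linarith
    · rw [if_neg ha, if_pos (by linarith : (hammingDist y t : ℝ) ≤ n * (D + γ))]
      split_ifs with hb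
      · simp
      · rw [mul_zero, sub_zero, sub_zero, hE, ← Real.exp_log hpos, ← Real.exp_add,
          log_blockBsc_eq h0 (by linarith), binEntropy_eq_log]
        refine Real.exp_le_one_iff.2 ?_
        have := mul_le_mul_of_nonneg_right (not_le.1 hb).le hκ
        linarith
  refine le_trans ?_ (Finset.sum_le_sum fun y _ => hpt y)
  rw [← Finset.mul_sum, Finset.sum_sub_distrib, Finset.sum_sub_distrib, sum_blockBsc, mul_comm]
  exact mul_le_mul_of_nonneg_left (by linarith) (Real.exp_pos _).le

end Volume

/-! ### Covering and binning -/

open scoped Classical in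
/-- Greedy covering: if every point is related to at least a fraction `β` of the centers, then `K`
centers can be chosen that leave at most a fraction `(1 - β) ^ K` of the points uncovered. -/
lemma exists_greedy_cover {X : Type*} [Fintype X] [Nonempty X] (R : X → X → Prop)
    {β : ℝ} (hβ1 : β ≤ 1)
    (hR : ∀ s, β * Fintype.card X ≤ ∑ t, (if R s t then (1 : ℝ) else 0)) (K : ℕ) :
    ∃ C : Finset X, C.card ≤ K ∧
      ∑ s, (if ∃ t ∈ C, R s t then (0 : ℝ) else 1) ≤ Fintype.card X * (1 - β) ^ K := by
  induction K with
  | zero => exact ⟨∅, by simp, by simp⟩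
  | succ K ih =>
    obtain ⟨C, hC, hunc⟩ := ih
    set w : X → ℝ := fun s => if ∃ t ∈ C, R s t then (0 : ℝ) else 1 with hw
    have hw0 : ∀ s, 0 ≤ w s := fun s => by simp only [hw]; split_ifs <;> norm_num
    obtain ⟨t, -, ht⟩ := Finset.exists_le_of_sum_le (s := (Finset.univ : Finset X))
      (f := fun _ => β * ∑ s, w s) (g := fun t => ∑ s, w s * (if R s t then (1 : ℝ) else 0))
      Finset.univ_nonempty (by
        rw [Finset.sum_comm]
        simp_rw [← Finset.mul_sum]
        rw [Finset.sum_const, nsmul_eq_mul, Finset.card_univ, ← mul_assoc, Finset.mul_sum]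
        refine Finset.sum_le_sum fun s _ => ?_
        rw [mul_comm]
        exact mul_le_mul_of_nonneg_left (hR s) (hw0 s))
    refine ⟨insert t C, (Finset.card_insert_le _ _).trans (by omega), ?_⟩
    have hnew : ∑ s, (if ∃ t' ∈ insert t C, R s t' then (0 : ℝ) else 1) =
        ∑ s, w s - ∑ s, w s * (if R s t then (1 : ℝ) else 0) := by
      rw [← Finset.sum_sub_distrib]
      refine Finset.sum_congr rfl fun s _ => ?_
      simp only [hw, Finset.mem_insert, exists_eq_or_imp]
      by_cases h1 : R s t <;> by_cases h2 : ∃ t' ∈ C, R s t' <;> simp [h1, h2]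
    rw [hnew, pow_succ]
    have := mul_le_mul_of_nonneg_right hunc (sub_nonneg.2 hβ1)
    linarith

/-- Random binning: some assignment of points to `M` bins puts at most a fraction `1 / M` of the
total weight of the pairs of distinct points on pairs in a common bin. -/
lemma exists_binning {T : Type*} [Fintype T] [DecidableEq T] {M : ℕ} (hM : 0 < M)
    (w : T → T → ℝ) (hw : ∀ t t', 0 ≤ w t t') :
    ∃ b : T → Fin M, M * ∑ t, ∑ t', (if t ≠ t' ∧ b t = b t' then w t t' else 0) ≤
      ∑ t, ∑ t', w t t' := by
  have : NeZero M := ⟨hM.ne'⟩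
  have hcount : ∀ t t' : T, t ≠ t' →
      M * ∑ b : T → Fin M, (if b t = b t' then (1 : ℝ) else 0) = Fintype.card (T → Fin M) := by
    intro t t' h
    rw [← (Equiv.funSplitAt t (Fin M)).symm.sum_comp, Fintype.sum_prod_type, Finset.sum_comm,
      Fintype.card_congr (Equiv.funSplitAt t (Fin M)), Fintype.card_prod]
    have : ∀ c : {j // j ≠ t} → Fin M, ∑ k : Fin M,
        (if (Equiv.funSplitAt t (Fin M)).symm (k, c) t =
          (Equiv.funSplitAt t (Fin M)).symm (k, c) t' then (1 : ℝ) else 0) = 1 := by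
      intro c
      simp [Ne.symm h]
    simp_rw [this]
    simp
  obtain ⟨b, -, hb⟩ := Finset.exists_le_of_sum_le (s := (Finset.univ : Finset (T → Fin M)))
    (f := fun b : T → Fin M => (M : ℝ) * ∑ t, ∑ t', (if t ≠ t' ∧ b t = b t' then w t t' else 0))
    (g := fun _ => ∑ t, ∑ t', w t t') Finset.univ_nonempty (by
      rw [← Finset.mul_sum, Finset.sum_comm, Finset.sum_const, nsmul_eq_mul, Finset.card_univ,
        Finset.mul_sum, Finset.mul_sum]
      refine Finset.sum_le_sum fun t _ => ?_
      rw [Finset.sum_comm, Finset.mul_sum, Finset.mul_sum]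
      refine Finset.sum_le_sum fun t' _ => ?_
      by_cases h : t = t'
      · simp only [h, ne_eq, not_true_eq_false, false_and, if_false, Finset.sum_const_zero,
          mul_zero]
        exact mul_nonneg (Nat.cast_nonneg _) (hw _ _)
      · rw [← hcount t t' h, mul_assoc, Finset.sum_mul]
        simp [h])
  exact ⟨b, hb⟩

/-! ### Achievability -/

section Achievability

variable {n : ℕ}

/-- Covering codes of nearly optimal size for Hamming balls of radius `n (D + γ)`. -/
lemma exists_coveringCode {D γ : ℝ} (h0 : 0 < D) (h1 : D ≤ 1 / 2) (hγ0 : 0 ≤ γ) (hγ1 : γ ≤ 1)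
    (hn : Real.exp (-(n * (γ ^ 2 / 4))) ≤ 1 / 4) :
    ∃ C : Finset (Fin n → Fin 2), (∀ s, ∃ t ∈ C, (hammingDist s t : ℝ) ≤ n * (D + γ)) ∧
      C.card * Real.exp (n * (Real.binEntropy D - γ * (Real.log (1 - D) - Real.log D))) ≤
        2 * (n + 2) * 2 ^ n := by
  classical
  set E := Real.exp (n * (Real.binEntropy D - γ * (Real.log (1 - D) - Real.log D))) with hE
  have hE0 : 0 < E := Real.exp_pos _
  have hball : ∀ s : Fin n → Fin 2, E / 2 ≤
      ∑ t, (if (hammingDist s t : ℝ) ≤ n * (D + γ) then (1 : ℝ) else 0) := by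
    intro s
    simp_rw [hammingDist_comm s]
    refine le_trans ?_ (le_card_ball h0 h1 hγ0 hγ1 s)
    nlinarith
  have h2n : (0 : ℝ) < 2 ^ n := by positivity
  -- the fraction of the space covered by a ball; `(n + 1) / β` greedy steps leave fewer than
  -- `2 ^ n * exp (-(n + 1)) < 1` words uncovered
  set β := E / 2 / 2 ^ n with hβ
  have hβ0 : 0 < β := by positivity
  have hβ1 : β ≤ 1 := by
    rw [hβ, div_le_one h2n, ← card_words (n := n)]
    refine (hball 0).trans ?_
    calc _ ≤ ∑ _t : Fin n → Fin 2, (1 : ℝ) :=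
          Finset.sum_le_sum fun t _ => by split_ifs <;> norm_num
      _ = _ := by simp
  obtain ⟨C, hC, hunc⟩ := exists_greedy_cover
    (fun s t : Fin n → Fin 2 => (hammingDist s t : ℝ) ≤ n * (D + γ)) hβ1
    (fun s => by
      rw [card_words, hβ, div_mul_cancel₀ _ h2n.ne']
      exact (hball s).trans_eq (Finset.sum_congr rfl fun t _ => by congr)) ⌈(n + 1) / β⌉₊
  refine ⟨C, ?_, ?_⟩
  · intro s
    by_contra hs
    have hsmall : (2 : ℝ) ^ n * (1 - β) ^ ⌈(n + 1) / β⌉₊ < 1 := by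
      have h3 : (1 - β) ^ ⌈(n + 1) / β⌉₊ ≤ Real.exp (-(n + 1)) := by
        calc (1 - β) ^ ⌈(n + 1) / β⌉₊ ≤ Real.exp (-β) ^ ⌈(n + 1) / β⌉₊ :=
              pow_le_pow_left₀ (by linarith) (Real.one_sub_le_exp_neg β) _
          _ = Real.exp (⌈(n + 1) / β⌉₊ * -β) := (Real.exp_nat_mul _ _).symm
          _ ≤ Real.exp (-(n + 1)) := by
              refine Real.exp_le_exp.2 ?_
              have := Nat.le_ceil (((n : ℝ) + 1) / β)
              rw [div_le_iff₀ hβ0] at this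
              linarith
      have h4 : (2 : ℝ) ^ n ≤ Real.exp n := by
        rw [← mul_one (n : ℝ), Real.exp_nat_mul]
        exact pow_le_pow_left₀ zero_le_two (by linarith [Real.add_one_le_exp 1]) n
      calc (2 : ℝ) ^ n * (1 - β) ^ ⌈(n + 1) / β⌉₊ ≤ Real.exp n * Real.exp (-(n + 1)) :=
            mul_le_mul h4 h3 (pow_nonneg (by linarith) _) (Real.exp_pos _).le
        _ = Real.exp (-1) := by rw [← Real.exp_add]; congr 1; ring
        _ < 1 := Real.exp_lt_one_iff.2 (by norm_num)
    rw [card_words] at hunc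
    have h5 := Finset.single_le_sum (f := fun s => if ∃ t ∈ C, (hammingDist s t : ℝ) ≤ n * (D + γ)
      then (0 : ℝ) else 1) (fun s _ => by split_ifs <;> norm_num) (Finset.mem_univ s)
    simp only [hs, if_false] at h5
    have h6 := h5.trans ((le_of_eq (Finset.sum_congr rfl fun t _ => by congr)).trans hunc)
    linarith
  · have hK : (⌈(n + 1) / β⌉₊ : ℝ) ≤ (n + 2) / β := by
      have h7 := (Nat.ceil_lt_add_one (by positivity : 0 ≤ ((n : ℝ) + 1) / β)).le
      have h8 : 1 ≤ 1 / β := (one_le_div hβ0).2 hβ1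
      refine h7.trans ?_
      rw [show ((n : ℝ) + 2) / β = (n + 1) / β + 1 / β by ring]
      linarith
    have hCK : (C.card : ℝ) ≤ (n + 2) / β := le_trans (by exact_mod_cast hC) hK
    rw [le_div_iff₀ hβ0, hβ, div_div, ← mul_div_assoc, div_le_iff₀ (by positivity)] at hCK
    linarith

open scoped Classical in
/-- The decoder of a binned code `C`: it returns some codeword of bin `m` within distance `n q` of
the side information, and the zero word if there is none. -/
noncomputable def binDecoder {M : ℕ} (C : Finset (Fin n → Fin 2)) (b : (Fin n → Fin 2) → Fin M)
    (q : ℝ) (m : Fin M) (y : Fin n → Fin 2) : Fin n → Fin 2 :=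
  if h : ∃ t ∈ C, b t = m ∧ (hammingDist y t : ℝ) ≤ n * q then h.choose else 0

/-- The probability that the target `φ s` lies in `t` while `t'` is a codeword compatible with the
side information. -/
noncomputable def collisionWeight (C : Finset (Fin n → Fin 2))
    (φ : (Fin n → Fin 2) → (Fin n → Fin 2)) (q a : ℝ) (t t' : Fin n → Fin 2) : ℝ :=
  ∑ s, ∑ y, (1 / 2) ^ n * blockBsc a s y *
    ((if φ s = t then 1 else 0) *
      ((if t' ∈ C then 1 else 0) * (if (hammingDist y t' : ℝ) ≤ n * q then 1 else 0)))

lemma collisionWeight_nonneg (C : Finset (Fin n → Fin 2))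
    (φ : (Fin n → Fin 2) → (Fin n → Fin 2)) (q : ℝ) {a : ℝ} (h0 : 0 ≤ a) (h1 : a ≤ 1)
    (t t' : Fin n → Fin 2) : 0 ≤ collisionWeight C φ q a t t' := by
  refine Finset.sum_nonneg fun s _ => Finset.sum_nonneg fun y _ => mul_nonneg
    (mul_nonneg (by positivity) (blockBsc_nonneg h0 h1 _ _)) ?_
  split_ifs <;> norm_num

/-- The side information is uniformly distributed, so that a codeword is compatible with it with
probability the relative volume of a ball. -/
lemma sum_collisionWeight_le (C : Finset (Fin n → Fin 2))
    (φ : (Fin n → Fin 2) → (Fin n → Fin 2)) {q : ℝ} (hq0 : 0 < q) (hq1 : q ≤ 1 / 2) (a : ℝ) :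
    ∑ t, ∑ t', collisionWeight C φ q a t t' ≤
      C.card * ((1 / 2) ^ n * Real.exp (n * Real.binEntropy q)) := by
  have hcol : ∀ t', ∑ t, collisionWeight C φ q a t t' =
      if t' ∈ C then (1 / 2) ^ n * ∑ y : Fin n → Fin 2,
        (if (hammingDist y t' : ℝ) ≤ n * q then 1 else 0) else 0 := by
    intro t'
    unfold collisionWeight
    rw [Finset.sum_comm]
    have h1 : ∀ s : Fin n → Fin 2, ∑ t, ∑ y, (1 / 2) ^ n * blockBsc a s y *
        ((if φ s = t then 1 else 0) *
          ((if t' ∈ C then 1 else 0) * (if (hammingDist y t' : ℝ) ≤ n * q then 1 else 0))) =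
        ∑ y, (1 / 2) ^ n * blockBsc a y s *
          ((if t' ∈ C then 1 else 0) * (if (hammingDist y t' : ℝ) ≤ n * q then 1 else 0)) := by
      intro s
      rw [Finset.sum_comm]
      refine Finset.sum_congr rfl fun y _ => ?_
      rw [← Finset.mul_sum, ← Finset.sum_mul, blockBsc_comm a s y]
      simp
    simp_rw [h1]
    rw [Finset.sum_comm]
    simp_rw [← Finset.sum_mul, ← Finset.mul_sum, sum_blockBsc]
    split_ifs with h
    · simp only [one_mul, mul_one, ← Finset.mul_sum]
    · simp
  rw [Finset.sum_comm]
  simp_rw [hcol]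
  rw [← Finset.sum_filter, Finset.filter_mem_eq_inter, Finset.univ_inter,
    ← nsmul_eq_mul (_ : ℕ) (_ * _ : ℝ)]
  exact Finset.sum_le_card_nsmul _ _ _ fun t' _ =>
    mul_le_mul_of_nonneg_left (card_ball_le hq0 hq1 t') (by positivity)

/-- Decoding fails only if the target is far from the side information, or if another codeword of
its bin is close to the side information. -/
lemma sum_binDecoder_ne_le {M : ℕ} {C : Finset (Fin n → Fin 2)} {b : (Fin n → Fin 2) → Fin M}
    {φ : (Fin n → Fin 2) → (Fin n → Fin 2)} {a x q γ : ℝ} (h0 : 0 ≤ a) (h1 : a ≤ 1 / 2)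
    (hφC : ∀ s, φ s ∈ C) (hφ : ∀ s, (hammingDist s (φ s) : ℝ) ≤ n * x)
    (hγ0 : 0 ≤ γ) (hγ1 : γ ≤ 1) (hq : binConv a x + γ ≤ q) :
    ∑ s, ∑ y, (1 / 2) ^ n * blockBsc a s y *
        (if binDecoder C b q (b (φ s)) y = φ s then 0 else 1) ≤
      Real.exp (-(n * (γ ^ 2 / 4))) +
        ∑ t, ∑ t', (if t ≠ t' ∧ b t = b t' then collisionWeight C φ q a t t' else 0) := by
  classical
  have hpt : ∀ s y : Fin n → Fin 2,
      (if binDecoder C b q (b (φ s)) y = φ s then (0 : ℝ) else 1) ≤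
        (if n * (binConv a x + γ) ≤ (hammingDist y (φ s) : ℝ) then 1 else 0) +
        ∑ t', (if φ s ≠ t' ∧ b (φ s) = b t' then 1 else 0) *
          ((if t' ∈ C then 1 else 0) * (if (hammingDist y t' : ℝ) ≤ n * q then 1 else 0)) := by
    intro s y
    have hsum0 : ∀ t' : Fin n → Fin 2, (0 : ℝ) ≤ (if φ s ≠ t' ∧ b (φ s) = b t' then 1 else 0) *
        ((if t' ∈ C then 1 else 0) * (if (hammingDist y t' : ℝ) ≤ n * q then 1 else 0)) := by
      intro t'
      split_ifs <;> norm_num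
    have hsum := Finset.sum_nonneg fun t' (_ : t' ∈ Finset.univ) => hsum0 t'
    by_cases hdec : binDecoder C b q (b (φ s)) y = φ s
    · rw [if_pos hdec]
      refine add_nonneg (by split_ifs <;> norm_num) hsum
    · rw [if_neg hdec]
      by_cases hfar : n * (binConv a x + γ) ≤ (hammingDist y (φ s) : ℝ)
      · rw [if_pos hfar]
        linarith
      · have hex : ∃ t ∈ C, b t = b (φ s) ∧ (hammingDist y t : ℝ) ≤ n * q :=
          ⟨φ s, hφC s, rfl, (not_le.1 hfar).le.trans
            (mul_le_mul_of_nonneg_left hq (Nat.cast_nonneg n))⟩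
        have hval : binDecoder C b q (b (φ s)) y = hex.choose := by
          unfold binDecoder
          rw [dif_pos hex]
        obtain ⟨hc1, hc2, hc3⟩ := hex.choose_spec
        rw [hval] at hdec
        have hone := Finset.single_le_sum (fun t' _ => hsum0 t') (Finset.mem_univ hex.choose)
        rw [if_pos ⟨Ne.symm hdec, hc2.symm⟩, if_pos hc1, if_pos hc3] at hone
        rw [if_neg hfar]
        linarith
  have hw : ∀ s y : Fin n → Fin 2, 0 ≤ (1 / 2) ^ n * blockBsc a s y := fun s y =>
    mul_nonneg (by positivity) (blockBsc_nonneg h0 (by linarith) _ _)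
  refine (Finset.sum_le_sum fun s _ => Finset.sum_le_sum fun y _ =>
    mul_le_mul_of_nonneg_left (hpt s y) (hw s y)).trans ?_
  simp_rw [mul_add, Finset.sum_add_distrib]
  refine add_le_add ?_ (le_of_eq ?_)
  · have hs : ∀ s : Fin n → Fin 2, ∑ y, (1 / 2) ^ n * blockBsc a s y *
        (if n * binConv a x + n * γ ≤ (hammingDist y (φ s) : ℝ) then 1 else 0) ≤
        (1 / 2) ^ n * Real.exp (-(n * (γ ^ 2 / 4))) := by
      intro s
      have hfar := sum_blockBsc_far_le h0 h1 (hφ s) hγ0 hγ1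
      simp_rw [mul_add] at hfar
      simp_rw [mul_assoc, ← Finset.mul_sum]
      exact mul_le_mul_of_nonneg_left hfar (by positivity)
    refine (Finset.sum_le_sum fun s _ => hs s).trans_eq ?_
    simp only [Finset.sum_const, Finset.card_univ, Fintype.card_fun, Fintype.card_fin,
      nsmul_eq_mul]
    push_cast
    rw [← mul_assoc, ← mul_pow]
    norm_num
  · symm
    have hpull : ∀ t t' : Fin n → Fin 2,
        (if t ≠ t' ∧ b t = b t' then collisionWeight C φ q a t t' else 0) =
        ∑ s, ∑ y, (1 / 2) ^ n * blockBsc a s y * ((if φ s = t then 1 else 0) *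
          ((if t ≠ t' ∧ b t = b t' then 1 else 0) *
          ((if t' ∈ C then 1 else 0) * (if (hammingDist y t' : ℝ) ≤ n * q then 1 else 0)))) := by
      intro t t'
      by_cases h : t ≠ t' ∧ b t = b t'
      · simp only [if_pos h, one_mul]
        rfl
      · simp only [if_neg h, zero_mul, mul_zero, Finset.sum_const_zero]
    simp_rw [hpull]
    calc _ = ∑ s, ∑ t, ∑ t', ∑ y, (1 / 2) ^ n * blockBsc a s y * ((if φ s = t then 1 else 0) *
          ((if t ≠ t' ∧ b t = b t' then 1 else 0) *
          ((if t' ∈ C then 1 else 0) * (if (hammingDist y t' : ℝ) ≤ n * q then 1 else 0)))) := by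
          exact (Finset.sum_congr rfl fun t _ => Finset.sum_comm).trans Finset.sum_comm
      _ = _ := by
          refine Finset.sum_congr rfl fun s _ => ?_
          rw [Finset.sum_eq_single (φ s)]
          · rw [Finset.sum_comm]
            simp_rw [if_true, one_mul, Finset.mul_sum]
          · intro t _ ht
            simp [Ne.symm ht]
          · simp

/-- A covering code with random binning serves two channels at once: both decoders recover the
codeword `φ s` that represents `s`. -/
lemma exists_binnedCode {D γ q α β : ℝ} (hD0 : 0 < D) (hD1 : D ≤ 1 / 2) (hγ0 : 0 ≤ γ)
    (hγ1 : γ ≤ 1) (hq0 : 0 < q) (hq1 : q ≤ 1 / 2) (hα0 : 0 ≤ α) (hα1 : α ≤ 1 / 2) (hβ0 : 0 ≤ β)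
    (hβ1 : β ≤ 1 / 2) (hqα : binConv α (D + γ) + γ ≤ q) (hqβ : binConv β (D + γ) + γ ≤ q)
    (hn : Real.exp (-(n * (γ ^ 2 / 4))) ≤ 1 / 4) {M : ℕ} (hM : 0 < M) :
    ∃ (φ : (Fin n → Fin 2) → (Fin n → Fin 2)) (enc : (Fin n → Fin 2) → Fin M)
      (dec : Fin M → (Fin n → Fin 2) → (Fin n → Fin 2)),
      (∀ s, (hammingDist s (φ s) : ℝ) ≤ n * (D + γ)) ∧
      ∀ a, a = α ∨ a = β →
        ∑ s, ∑ y, (1 / 2) ^ n * blockBsc a s y * (if dec (enc s) y = φ s then 0 else 1) ≤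
          Real.exp (-(n * (γ ^ 2 / 4))) + 4 * (n + 2) * Real.exp (n * (Real.binEntropy q -
            Real.binEntropy D + γ * (Real.log (1 - D) - Real.log D))) / M := by
  obtain ⟨C, hcov, hcard⟩ := exists_coveringCode hD0 hD1 hγ0 hγ1 hn
  choose φ hφC hφ using hcov
  have hM' : (0 : ℝ) < M := by exact_mod_cast hM
  have hwα := collisionWeight_nonneg C φ q hα0 (by linarith : α ≤ 1)
  have hwβ := collisionWeight_nonneg C φ q hβ0 (by linarith : β ≤ 1)
  obtain ⟨b, hb⟩ := exists_binning hM
    (fun t t' => collisionWeight C φ q α t t' + collisionWeight C φ q β t t')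
    fun t t' => add_nonneg (hwα t t') (hwβ t t')
  have hweight : ∑ t, ∑ t', (collisionWeight C φ q α t t' + collisionWeight C φ q β t t') ≤
      4 * (n + 2) * Real.exp (n * (Real.binEntropy q -
            Real.binEntropy D + γ * (Real.log (1 - D) - Real.log D))) := by
    simp_rw [Finset.sum_add_distrib]
    have h1 := sum_collisionWeight_le C φ hq0 hq1 α
    have h2 := sum_collisionWeight_le C φ hq0 hq1 β
    have h3 : (C.card : ℝ) * ((1 / 2) ^ n * Real.exp (n * Real.binEntropy q)) ≤
        2 * (n + 2) * Real.exp (n * (Real.binEntropy q -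
            Real.binEntropy D + γ * (Real.log (1 - D) - Real.log D))) := by
      set E := Real.exp (n * (Real.binEntropy D - γ * (Real.log (1 - D) - Real.log D))) with hE
      set F := Real.exp (n * (Real.binEntropy q -
        Real.binEntropy D + γ * (Real.log (1 - D) - Real.log D))) with hF
      have hEF : Real.exp (n * Real.binEntropy q) = E * F := by
        rw [hE, hF, ← Real.exp_add]
        congr 1
        ring
      have hF0 : 0 ≤ (1 / 2) ^ n * F := mul_nonneg (by positivity) (Real.exp_pos _).le
      calc (C.card : ℝ) * ((1 / 2) ^ n * Real.exp (n * Real.binEntropy q))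
          = C.card * E * ((1 / 2) ^ n * F) := by rw [hEF]; ring
        _ ≤ 2 * (n + 2) * 2 ^ n * ((1 / 2) ^ n * F) := mul_le_mul_of_nonneg_right hcard hF0
        _ = 2 * (n + 2) * F * (2 * (1 / 2)) ^ n := by rw [mul_pow]; ring
        _ = 2 * (n + 2) * F := by norm_num
    linarith
  have hcoll := hb.trans hweight
  rw [mul_comm, ← le_div_iff₀ hM'] at hcoll
  refine ⟨φ, fun s => b (φ s), binDecoder C b q, hφ, ?_⟩
  rintro a (rfl | rfl)
  · refine (sum_binDecoder_ne_le hα0 hα1 hφC hφ hγ0 hγ1 hqα).trans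
      (add_le_add le_rfl (le_trans ?_ hcoll))
    refine Finset.sum_le_sum fun t _ => Finset.sum_le_sum fun t' _ => ?_
    split_ifs
    · exact le_add_of_nonneg_right (hwβ _ _)
    · exact le_rfl
  · refine (sum_binDecoder_ne_le hβ0 hβ1 hφC hφ hγ0 hγ1 hqβ).trans
      (add_le_add le_rfl (le_trans ?_ hcoll))
    refine Finset.sum_le_sum fun t _ => Finset.sum_le_sum fun t' _ => ?_
    split_ifs
    · exact le_add_of_nonneg_left (hwα _ _)
    · exact le_rfl

lemma sum_sum_sum_blockBsc_right (ρ δ : ℝ) (F : (Fin n → Fin 2) → (Fin n → Fin 2) → ℝ) :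
    ∑ s : Fin n → Fin 2, ∑ u : Fin n → Fin 2, ∑ v : Fin n → Fin 2,
        (1 / 2) ^ n * blockBsc ρ s u * blockBsc δ u v * F s v =
      ∑ s, ∑ v, (1 / 2) ^ n * blockBsc (binConv ρ δ) s v * F s v := by
  refine Finset.sum_congr rfl fun s _ => ?_
  rw [Finset.sum_comm]
  refine Finset.sum_congr rfl fun v _ => ?_
  rw [← Finset.sum_mul, ← sum_blockBsc_mul_blockBsc, Finset.mul_sum]
  simp_rw [mul_assoc]

lemma sum_hammingDist_le_of_target {a x e : ℝ} (h0 : 0 ≤ a) (h1 : a ≤ 1)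
    {φ : (Fin n → Fin 2) → (Fin n → Fin 2)}
    {r : (Fin n → Fin 2) → (Fin n → Fin 2) → (Fin n → Fin 2)}
    (hφ : ∀ s, (hammingDist s (φ s) : ℝ) ≤ n * x) (hx : 0 ≤ x)
    (he : ∑ s, ∑ y, (1 / 2) ^ n * blockBsc a s y * (if r s y = φ s then 0 else 1) ≤ e) :
    ∑ s, ∑ y, (1 / 2) ^ n * blockBsc a s y * (hammingDist s (r s y) : ℝ) ≤ n * (x + e) := by
  have hpt : ∀ s y : Fin n → Fin 2,
      (1 / 2) ^ n * blockBsc a s y * (hammingDist s (r s y) : ℝ) ≤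
      n * x * ((1 / 2) ^ n * blockBsc a s y) +
        n * ((1 / 2) ^ n * blockBsc a s y * (if r s y = φ s then 0 else 1)) := by
    intro s y
    have hw : 0 ≤ (1 / 2) ^ n * blockBsc a s y :=
      mul_nonneg (by positivity) (blockBsc_nonneg h0 h1 _ _)
    have hd : (hammingDist s (r s y) : ℝ) ≤ n * x + n * (if r s y = φ s then 0 else 1) := by
      split_ifs with h
      · rw [h]
        simpa using hφ s
      · have := hammingDist_le_length s (r s y)
        have : 0 ≤ n * x := by positivity
        linarith
    nlinarith [mul_le_mul_of_nonneg_left hd hw]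
  refine (Finset.sum_le_sum fun s _ => Finset.sum_le_sum fun y _ => hpt s y).trans ?_
  simp_rw [Finset.sum_add_distrib, ← Finset.mul_sum]
  have hone := sum_half_pow_mul_blockBsc (n := n) a
  simp_rw [← Finset.mul_sum] at hone
  rw [hone]
  have := mul_le_mul_of_nonneg_left he (Nat.cast_nonneg (α := ℝ) n)
  linarith

lemma messageCount_pos (n : ℕ) (r : ℝ) : 0 < messageCount n r :=
  Nat.ceil_pos.2 (Real.rpow_pos_of_pos two_pos _)

lemma tendsto_error_bound {γ : ℝ} (hγ : 0 < γ) :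
    Tendsto (fun n : ℕ => Real.exp (-(n * (γ ^ 2 / 4))) + 4 * (n + 2) * Real.exp (-(n * γ)))
      atTop (𝓝 0) := by
  have hexp : ∀ c : ℝ, 0 < c → Tendsto (fun n : ℕ => Real.exp (-(n * c))) atTop (𝓝 0) := by
    intro c hc
    exact Real.tendsto_exp_neg_atTop_nhds_zero.comp
      (tendsto_natCast_atTop_atTop.atTop_mul_const hc)
  have hlin : Tendsto (fun n : ℕ => (n : ℝ) * Real.exp (-(n * γ))) atTop (𝓝 0) := by
    have h := (Real.tendsto_pow_mul_exp_neg_atTop_nhds_zero 1).comp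
      (tendsto_natCast_atTop_atTop.atTop_mul_const hγ : Tendsto (fun n : ℕ => (n : ℝ) * γ) _ _)
    have h2 := h.const_mul (1 / γ)
    rw [mul_zero] at h2
    refine h2.congr fun n => ?_
    simp only [Function.comp_apply, pow_one]
    field_simp
  have h := (hexp (γ ^ 2 / 4) (by positivity)).add
    ((hlin.const_mul 4).add ((hexp γ hγ).const_mul 8))
  simp only [mul_zero, add_zero] at h
  refine h.congr fun n => ?_
  ring

/-- Every common rate above `h(q) - h(D)` is admissible, with any private rate, as soon as `q`
exceeds the distance at which the reconstruction is seen from either side information. -/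
lemma mem_binaryRegion_of_lt {ρ δ : I} {D q : ℝ} (hD0 : 0 < D) (hD1 : D < 1 / 2)
    (hρ : (ρ : ℝ) ≤ 1 / 2) (hδ : binConv (ρ : ℝ) δ ≤ 1 / 2) (hq1 : q ≤ 1 / 2)
    (hqρ : binConv ρ D < q) (hqδ : binConv (binConv (ρ : ℝ) δ) D < q) {r : ℝ × ℝ}
    (hr1 : 0 ≤ r.1) (hr2 : 0 ≤ r.2)
    (hr : Real.binEntropy q - Real.binEntropy D < r.1 * Real.log 2) :
    r ∈ binaryRegion D ρ δ := by
  have hσ0 : 0 ≤ binConv (ρ : ℝ) δ := binConv_nonneg ρ.2.1 ρ.2.2 δ.2.1 δ.2.2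
  have hq0 : 0 < q := lt_of_le_of_lt
    (binConv_nonneg ρ.2.1 ρ.2.2 hD0.le (by linarith)) hqρ
  refine ⟨hr1, hr2, fun ε hε N => ?_⟩
  have ev : ∀ (f : ℝ → ℝ) (_ : Continuous f) (c : ℝ), f 0 < c → ∀ᶠ γ in 𝓝[>] (0 : ℝ), f γ < c :=
    fun f hf c hc => ((hf.tendsto' 0 _ rfl).mono_left nhdsWithin_le_nhds).eventually_lt_const hc
  -- one slack `γ` serves as excess distortion, as margin for the channel noise and as excess rate
  obtain ⟨γ, ⟨⟨⟨⟨hγρ, hγδ⟩, hγε⟩, hγ1⟩, hγr⟩, hγ0⟩ :=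
    (((((ev (fun γ => binConv ρ (D + γ) + γ) (by unfold binConv; fun_prop) q
        (by simpa using hqρ)).and
      (ev (fun γ => binConv (binConv ρ δ) (D + γ) + γ) (by unfold binConv; fun_prop) q
        (by simpa using hqδ))).and
      (ev (fun γ => γ) continuous_id (ε / 2) (by simpa using hε))).and
      (ev (fun γ => γ) continuous_id 1 one_pos)).and
      (ev (fun γ => Real.binEntropy q - Real.binEntropy D +
        γ * (Real.log (1 - D) - Real.log D) + γ) (by fun_prop) (r.1 * Real.log 2)
        (by simpa using hr))).and self_mem_nhdsWithin |>.exists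
  replace hγ0 : 0 < γ := hγ0
  have hlim := tendsto_error_bound hγ0
  obtain ⟨n, hnη, hn4, hn0, hnN⟩ := ((hlim.eventually_lt_const (half_pos (half_pos hε))).and
    ((hlim.eventually_lt_const (by norm_num : (0 : ℝ) < 1 / 4)).and
      ((eventually_gt_atTop 0).and (eventually_ge_atTop N)))).exists
  have hnpos : (0 : ℝ) < n := by exact_mod_cast hn0
  refine ⟨n, hnN, ?_⟩
  obtain ⟨φ, enc, dec, hφ, herr⟩ := exists_binnedCode (n := n) hD0 hD1.le hγ0.le hγ1.le hq0 hq1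
    ρ.2.1 hρ hσ0 hδ hγρ.le hγδ.le (by
      have : 0 ≤ 4 * ((n : ℝ) + 2) * Real.exp (-(n * γ)) := by positivity
      linarith) (messageCount_pos n (r.1 + ε))
  set η := Real.exp (-(n * (γ ^ 2 / 4))) + 4 * (n + 2) * Real.exp (-(n * γ)) with hη
  have herr' : ∀ a, a = (ρ : ℝ) ∨ a = binConv (ρ : ℝ) δ →
      ∑ s, ∑ y, (1 / 2) ^ n * blockBsc a s y * (if dec (enc s) y = φ s then 0 else 1) ≤ η := by
    intro a ha
    refine (herr a ha).trans ?_
    rw [hη, mul_div_assoc]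
    refine add_le_add le_rfl (mul_le_mul_of_nonneg_left ?_ (by positivity))
    rw [div_le_iff₀ (by exact_mod_cast messageCount_pos n (r.1 + ε))]
    have hM : Real.exp (n * (r.1 * Real.log 2)) ≤ messageCount n (r.1 + ε) := by
      refine le_trans ?_ (Nat.le_ceil _)
      rw [two_rpow_eq_exp]
      refine Real.exp_le_exp.2 ?_
      have := mul_pos (mul_pos hnpos hε) (Real.log_pos one_lt_two)
      linarith
    refine le_trans ?_ (mul_le_mul_of_nonneg_left hM (Real.exp_pos _).le)
    rw [← Real.exp_add]
    refine Real.exp_le_exp.2 ?_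
    have := mul_lt_mul_of_pos_left hγr hnpos
    linarith
  have hUerr := herr' ρ (Or.inl rfl)
  have hVerr := herr' (binConv ρ δ) (Or.inr rfl)
  have hη0 : η ≤ ε / 4 := by linarith
  let c : CRRCode (Fin 2) (Fin 2) (Fin 2) (Fin 2) n (messageCount n (r.1 + ε))
      (messageCount n (r.2 + ε)) :=
    { encUV := enc
      encV := fun _ => ⟨0, messageCount_pos _ _⟩
      decU := dec
      decV := fun m _ v => dec m v }
  have hbound : (n : ℝ) * (D + γ + η) ≤ n * (D + ε) :=
    mul_le_mul_of_nonneg_left (by linarith) hnpos.le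
  refine ⟨c, ?_, ?_, ?_⟩
  · rw [iidExp_sum, iidExp_binarySource, one_div_mul_eq_div, div_le_iff₀ hnpos, mul_comm (D + ε)]
    refine le_trans (le_of_eq ?_) ((sum_hammingDist_le_of_target ρ.2.1 ρ.2.2 hφ (by linarith)
      hUerr).trans hbound)
    rw [← sum_sum_sum_blockBsc ρ δ]
    refine Finset.sum_congr rfl fun s _ => Finset.sum_congr rfl fun u _ =>
        Finset.sum_congr rfl fun v _ => ?_
    congr 1
    exact sum_hammingDistortion s (dec (enc s) u)
  · rw [iidExp_sum, iidExp_binarySource, one_div_mul_eq_div, div_le_iff₀ hnpos, mul_comm (D + ε)]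
    refine le_trans (le_of_eq ?_) ((sum_hammingDist_le_of_target hσ0 (by linarith) hφ (by linarith)
      hVerr).trans hbound)
    rw [← sum_sum_sum_blockBsc_right ρ δ]
    refine Finset.sum_congr rfl fun s _ => Finset.sum_congr rfl fun u _ =>
        Finset.sum_congr rfl fun v _ => ?_
    congr 1
    exact sum_hammingDistortion s (dec (enc s) v)
  · rw [iidProb, iidExp_binarySource]
    rw [← sum_sum_sum_blockBsc ρ δ] at hUerr
    rw [← sum_sum_sum_blockBsc_right ρ δ] at hVerr
    refine le_trans ?_ ((add_le_add hUerr hVerr).trans (by linarith))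
    simp only [← Finset.sum_add_distrib]
    refine Finset.sum_le_sum fun s _ => Finset.sum_le_sum fun u _ =>
        Finset.sum_le_sum fun v _ => ?_
    rw [← mul_add]
    refine mul_le_mul_of_nonneg_left ?_ (mul_nonneg (mul_nonneg (by positivity)
      (blockBsc_nonneg ρ.2.1 ρ.2.2 _ _)) (blockBsc_nonneg δ.2.1 δ.2.2 _ _))
    rw [Set.indicator_apply]
    change (if dec (enc s) u ≠ dec (enc s) v then (1 : ℝ) else 0) ≤ _
    by_cases h1 : dec (enc s) u = φ s
    · by_cases h2 : dec (enc s) v = φ s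
      · simp [h1, h2]
      · simp only [h1, h2, if_true, if_false]
        split_ifs <;> norm_num
    · simp only [h1, if_false]
      split_ifs <;> norm_num

end Achievability

/-! ### The endpoints -/

/-- Complementing the letters of the second side information exchanges the crossover probabilities
`δ` and `1 - δ`. -/
lemma iidExp_binarySource_symm (ρ δ : I) (n : ℕ) (f : (Fin n → Fin 2 × Fin 2 × Fin 2) → ℝ) :
    iidExp (binarySource ρ (unitInterval.symm δ)) n f =
      iidExp (binarySource ρ δ) n fun ω => f fun i => ((ω i).1, (ω i).2.1, (ω i).2.2.rev) := by
  unfold iidExp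
  let e : (Fin n → Fin 2 × Fin 2 × Fin 2) ≃ (Fin n → Fin 2 × Fin 2 × Fin 2) :=
    Equiv.piCongrRight fun _ => (Equiv.refl _).prodCongr ((Equiv.refl _).prodCongr Fin.revPerm)
  rw [← e.sum_comp]
  refine Finset.sum_congr rfl fun ω _ => ?_
  refine congrArg₂ _ (Finset.prod_congr rfl fun i _ => ?_) rfl
  have h : ∀ x y : Fin 2, bsc (1 - δ) x y.rev = bsc δ x y := by
    intro x y
    fin_cases x <;> fin_cases y <;> simp [bsc, Fin.rev]
  change 1 / 2 * bsc ρ (ω i).1 (ω i).2.1 * bsc (1 - δ) (ω i).2.1 (ω i).2.2.rev = _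
  rw [h]
  rfl

lemma binaryRegion_subset_symm (D : ℝ) (ρ δ : I) :
    binaryRegion D ρ δ ⊆ binaryRegion D ρ (unitInterval.symm δ) := by
  rintro r ⟨h1, h2, h⟩
  refine ⟨h1, h2, fun ε hε N => ?_⟩
  obtain ⟨n, hn, c, hU, hV, hP⟩ := h ε hε N
  let c' : CRRCode (Fin 2) (Fin 2) (Fin 2) (Fin 2) n (messageCount n (r.1 + ε))
      (messageCount n (r.2 + ε)) :=
    { c with decV := fun m m' v => c.decV m m' fun i => (v i).rev }
  have hrecV : ∀ ω : Fin n → Fin 2 × Fin 2 × Fin 2,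
      c'.recV (fun i => ((ω i).1, (ω i).2.1, (ω i).2.2.rev)) = c.recV ω := by
    intro ω
    simp [c', CRRCode.recV]
  refine ⟨n, hn, c', ?_, ?_, ?_⟩
  · simp_rw [iidExp_binarySource_symm]
    exact hU
  · simp_rw [iidExp_binarySource_symm, hrecV]
    exact hV
  · rw [iidProb, iidExp_binarySource_symm]
    refine le_trans (le_of_eq ?_) hP
    rw [iidProb]
    congr 1
    funext ω
    rw [Set.indicator_apply, Set.indicator_apply]
    refine if_congr ?_ rfl rfl
    change c'.recU _ ≠ c'.recV _ ↔ c.recU ω ≠ c.recV ω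
    rw [hrecV]
    rfl

lemma binaryRegion_symm (D : ℝ) (ρ δ : I) :
    binaryRegion D ρ (unitInterval.symm δ) = binaryRegion D ρ δ := by
  refine Set.Subset.antisymm ?_ (binaryRegion_subset_symm D ρ δ)
  simpa using binaryRegion_subset_symm D ρ (unitInterval.symm δ)

lemma sum_blockBsc_mul_hammingDist (a : ℝ) {n : ℕ} (s : Fin n → Fin 2) :
    ∑ y, blockBsc a s y * (hammingDist s y : ℝ) = n * a := by
  simp_rw [hammingDist_comm s, ← sum_hammingDistortion]
  rw [sum_blockBsc_mul_sum a s fun i c => (hammingDistortion c (s i) : ℝ)]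
  simp_rw [sum_bsc_mul_hammingDistortion]
  simp [hammingDistortion]

/-- If the side informations coincide, they are a common reconstruction at rate zero. -/
lemma binaryRegion_zero {ρ : I} {D : ℝ} (hρD : (ρ : ℝ) ≤ D) :
    binaryRegion D ρ 0 = Set.Ici 0 ×ˢ Set.Ici 0 := by
  refine Set.Subset.antisymm (fun r hr => ⟨hr.1, hr.2.1⟩) ?_
  rintro r ⟨hr1, hr2⟩
  refine ⟨hr1, hr2, fun ε hε N => ⟨N + 1, N.le_succ, ?_⟩⟩
  set n := N + 1 with hn
  have hnpos : (0 : ℝ) < n := by rw [hn]; positivity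
  let c : CRRCode (Fin 2) (Fin 2) (Fin 2) (Fin 2) n (messageCount n (r.1 + ε))
      (messageCount n (r.2 + ε)) :=
    { encUV := fun _ => ⟨0, messageCount_pos _ _⟩
      encV := fun _ => ⟨0, messageCount_pos _ _⟩
      decU := fun _ u => u
      decV := fun _ _ v => v }
  have hdist : ∑ s : Fin n → Fin 2, ∑ y : Fin n → Fin 2,
      (1 / 2) ^ n * blockBsc (ρ : ℝ) s y * (hammingDist s y : ℝ) ≤
      n * (D + ε) := by
    simp_rw [mul_assoc, ← Finset.mul_sum, sum_blockBsc_mul_hammingDist]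
    simp only [Finset.sum_const, Finset.card_univ, Fintype.card_fun, Fintype.card_fin,
      nsmul_eq_mul]
    push_cast
    rw [← mul_assoc, ← mul_pow]
    norm_num
    exact mul_le_mul_of_nonneg_left (by linarith) hnpos.le
  refine ⟨c, ?_, ?_, ?_⟩
  · rw [iidExp_sum, iidExp_binarySource, one_div_mul_eq_div, div_le_iff₀ hnpos, mul_comm (D + ε)]
    refine le_trans (le_of_eq ?_) hdist
    rw [← sum_sum_sum_blockBsc ρ (0 : I)]
    refine Finset.sum_congr rfl fun s _ => Finset.sum_congr rfl fun u _ =>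
        Finset.sum_congr rfl fun v _ => ?_
    congr 1
    exact sum_hammingDistortion s u
  · rw [iidExp_sum, iidExp_binarySource, one_div_mul_eq_div, div_le_iff₀ hnpos, mul_comm (D + ε)]
    refine le_trans (le_of_eq ?_) hdist
    have hconv : binConv (ρ : ℝ) (0 : I) = ρ := by simp [binConv]
    rw [← hconv, ← sum_sum_sum_blockBsc_right ρ (0 : I), hconv]
    refine Finset.sum_congr rfl fun s _ => Finset.sum_congr rfl fun u _ =>
        Finset.sum_congr rfl fun v _ => ?_
    congr 1
    exact sum_hammingDistortion s v
  · rw [iidProb, iidExp_binarySource]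
    refine le_of_eq_of_le ?_ hε.le
    refine Finset.sum_eq_zero fun s _ => Finset.sum_eq_zero fun u _ =>
        Finset.sum_eq_zero fun v _ => ?_
    rw [Set.indicator_apply]
    change _ * (if u ≠ v then (1 : ℝ) else 0) = 0
    by_cases h : u = v
    · simp [h]
    · obtain ⟨i, hi⟩ := Function.ne_iff.1 h
      have h0 : blockBsc ((0 : I) : ℝ) u v = 0 :=
        Finset.prod_eq_zero (Finset.mem_univ i) (by simp [bsc, Ne.symm hi])
      rw [h0, mul_zero, zero_mul]

/-! ### Limits of the regions -/

lemma rate_pos {ρ D : ℝ} (hρ : 0 < ρ) (hρD : ρ < D) (hD : D < 1 / 2) :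
    0 < binEntropyBits (binConv ρ D) - binEntropyBits D := by
  have hlt : D < binConv ρ D := by unfold binConv; nlinarith
  have hle := (le_binConv_and_binConv_le hρ.le (by linarith) hD.le).2
  rw [binConv_comm] at hle
  unfold binEntropyBits
  rw [← sub_div]
  refine div_pos (sub_pos.2 ?_) (Real.log_pos one_lt_two)
  exact Real.binEntropy_strictMonoOn ⟨by linarith, by linarith⟩ ⟨by linarith, by linarith⟩ hlt

lemma eventually_mem_binaryRegion {ρ : I} {D : ℝ} (hρ : (0 : ℝ) < ρ) (hρD : (ρ : ℝ) < D)
    (hD : D < 1 / 2) {r : ℝ × ℝ} (hr1 : binEntropyBits (binConv ρ D) - binEntropyBits D < r.1)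
    (hr2 : 0 ≤ r.2) : ∀ᶠ δ in 𝓝 (0 : I), r ∈ binaryRegion D ρ δ := by
  have hlog2 := Real.log_pos one_lt_two
  have hhalf : binConv ρ D < 1 / 2 := by unfold binConv; nlinarith
  have hr : Real.binEntropy (binConv ρ D) - Real.binEntropy D < r.1 * Real.log 2 := by
    unfold binEntropyBits at hr1
    rwa [← sub_div, div_lt_iff₀ hlog2] at hr1
  have hq : ∀ᶠ q in 𝓝[>] (binConv (ρ : ℝ) D),
      Real.binEntropy q - Real.binEntropy D < r.1 * Real.log 2 :=
    ((Real.binEntropy_continuous.sub continuous_const).tendsto' _ _ rfl |>.mono_left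
      nhdsWithin_le_nhds).eventually_lt_const hr
  obtain ⟨q, ⟨hq1, hq2⟩, hq3⟩ := ((hq.and (eventually_nhdsWithin_of_eventually_nhds
    (eventually_lt_nhds hhalf))).and self_mem_nhdsWithin).exists
  replace hq3 : binConv ρ D < q := hq3
  have e1 : ∀ᶠ δ : I in 𝓝 0, binConv (ρ : ℝ) δ < 1 / 2 := by
    have hc : Continuous fun δ : I => binConv (ρ : ℝ) δ := by unfold binConv; fun_prop
    refine (hc.tendsto' 0 _ rfl).eventually_lt_const ?_
    simp only [binConv, Set.Icc.coe_zero]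
    linarith
  have e2 : ∀ᶠ δ : I in 𝓝 0, binConv (binConv (ρ : ℝ) δ) D < q := by
    have hc : Continuous fun δ : I => binConv (binConv (ρ : ℝ) δ) D := by unfold binConv; fun_prop
    refine (hc.tendsto' 0 _ rfl).eventually_lt_const ?_
    simpa [binConv] using hq3
  filter_upwards [e1, e2] with δ h1 h2
  exact mem_binaryRegion_of_lt (by linarith) hD (by linarith) h1.le hq2.le hq3 h2
    ((rate_pos hρ hρD hD).trans hr1).le hr2 hq1

lemma tendsto_symm_nhdsLT_one : Tendsto unitInterval.symm (𝓝[<] (1 : I)) (𝓝[>] (0 : I)) := by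
  refine tendsto_nhdsWithin_iff.2 ⟨?_, ?_⟩
  · exact (unitInterval.continuous_symm.tendsto' 1 0 unitInterval.symm_one).mono_left
      nhdsWithin_le_nhds
  · filter_upwards [self_mem_nhdsWithin] with δ hδ
    have h : (δ : ℝ) < 1 := by exact_mod_cast (hδ : δ < 1)
    change (0 : ℝ) < 1 - δ
    linarith

/-- Painlevé–Kuratowski convergence to a closed set `L` of sets that eventually lie in `L` and
eventually contain each point of a set whose closure contains `L`. -/
lemma setTendsto_of_subset_of_dense {α X : Type*} [TopologicalSpace X] {F : α → Set X}
    {l : Filter α} [l.NeBot] {L T : Set X} (hL : IsClosed L) (hsub : ∀ᶠ a in l, F a ⊆ L)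
    (hT : L ⊆ closure T) (hmem : ∀ x ∈ T, ∀ᶠ a in l, x ∈ F a) : SetTendsto F l L := by
  have h1 : kuratowskiLiminf F l ⊆ kuratowskiLimsup F l := fun x hx W hW => (hx W hW).frequently
  have h2 : kuratowskiLimsup F l ⊆ L := by
    intro x hx
    rw [← hL.closure_eq, mem_closure_iff_nhds]
    intro W hW
    obtain ⟨a, ⟨y, hyF, hyW⟩, ha⟩ := ((hx W hW).and_eventually hsub).exists
    exact ⟨y, hyW, ha hyF⟩
  have h3 : L ⊆ kuratowskiLiminf F l := by
    intro x hx W hW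
    obtain ⟨y, hyW, hyT⟩ := mem_closure_iff_nhds.1 (hT hx) W hW
    exact (hmem y hyT).mono fun a ha => ⟨y, ha, hyW⟩
  exact ⟨(h1.trans h2).antisymm h3, h2.antisymm (h3.trans h1)⟩

lemma continuous_binarySource (ρ : I) : Continuous fun δ : I => binarySource ρ δ := by
  refine Continuous.subtype_mk (continuous_pi fun x => ?_) _
  unfold bsc
  split_ifs <;> fun_prop

/-- If the region at `δ₀` contains the origin but nearby regions avoid a neighborhood of it, then
the region is discontinuous as a function of the source. -/
lemma not_setTendsto_binarySource {ρ δ₀ : I} {D G : ℝ} {l : Filter I} [l.NeBot] (hl : l ≤ 𝓝 δ₀)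
    (hG : 0 < G) (h0 : (0 : ℝ × ℝ) ∈ binaryRegion D ρ δ₀)
    (hsub : ∀ᶠ δ in l, binaryRegion D ρ δ ⊆ Set.Ici G ×ˢ Set.Ici 0) :
    ¬ SetTendsto (fun p : SourcePMF (Fin 2) (Fin 2) (Fin 2) =>
        admissibleRegion hammingDistortion D p)
      (𝓝 (binarySource ρ δ₀)) (admissibleRegion hammingDistortion D (binarySource ρ δ₀)) := by
  rintro ⟨h, -⟩
  have hmem : (0 : ℝ × ℝ) ∈ kuratowskiLiminf (fun p : SourcePMF (Fin 2) (Fin 2) (Fin 2) =>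
      admissibleRegion hammingDistortion D p) (𝓝 (binarySource ρ δ₀)) := by
    rw [h]
    exact h0
  have hW : {x : ℝ × ℝ | x.1 < G} ∈ 𝓝 (0 : ℝ × ℝ) :=
    (isOpen_lt continuous_fst continuous_const).mem_nhds hG
  have hev := (((continuous_binarySource ρ).tendsto δ₀).mono_left hl).eventually (hmem _ hW)
  obtain ⟨δ, ⟨x, hx, hxG⟩, hδ⟩ := (hev.and hsub).exists
  exact not_le.2 hxG (Set.mem_Ici.1 (hδ hx).1)

theorem mainTheorem6 (ρ : I) (D : ℝ) (hρ : (0 : ℝ) < ρ) (hρD : (ρ : ℝ) < D) (hD : D < 1 / 2) :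
    -- limits at the two endpoints of the parameter interval
    SetTendsto (fun δ : I => binaryRegion D ρ δ) (𝓝[>] 0)
      (Set.Ici (binEntropyBits (binConv ρ D) - binEntropyBits D) ×ˢ Set.Ici 0) ∧
    SetTendsto (fun δ : I => binaryRegion D ρ δ) (𝓝[<] 1)
      (Set.Ici (binEntropyBits (binConv ρ D) - binEntropyBits D) ×ˢ Set.Ici 0) ∧
    -- values at the two endpoints
    binaryRegion D ρ 0 = Set.Ici 0 ×ˢ Set.Ici 0 ∧
    binaryRegion D ρ 1 = Set.Ici 0 ×ˢ Set.Ici 0 ∧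
    -- the limits are not the values
    Set.Ici (binEntropyBits (binConv ρ D) - binEntropyBits D) ×ˢ Set.Ici 0 ≠
      binaryRegion D ρ 0 ∧
    Set.Ici (binEntropyBits (binConv ρ D) - binEntropyBits D) ×ˢ Set.Ici 0 ≠
      binaryRegion D ρ 1 ∧
    -- the region, as a function of the source pmf, is discontinuous at both endpoint sources
    ¬ SetTendsto (fun p : SourcePMF (Fin 2) (Fin 2) (Fin 2) =>
        admissibleRegion hammingDistortion D p)
      (𝓝 (binarySource ρ 0)) (admissibleRegion hammingDistortion D (binarySource ρ 0)) ∧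
    ¬ SetTendsto (fun p : SourcePMF (Fin 2) (Fin 2) (Fin 2) =>
        admissibleRegion hammingDistortion D p)
      (𝓝 (binarySource ρ 1)) (admissibleRegion hammingDistortion D (binarySource ρ 1)) := by
  have : (𝓝[>] (0 : I)).NeBot := nhdsGT_neBot_of_exists_gt ⟨1, zero_lt_one⟩
  have : (𝓝[<] (1 : I)).NeBot := nhdsLT_neBot_of_exists_lt ⟨0, zero_lt_one⟩
  have hG := rate_pos hρ hρD hD
  set G := binEntropyBits (binConv ρ D) - binEntropyBits D with hGdef
  have hsub : ∀ δ : I, 0 < δ → δ < 1 → binaryRegion D ρ δ ⊆ Set.Ici G ×ˢ Set.Ici 0 :=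
    fun δ h0 h1 r hr => ⟨le_fst_of_mem_binaryRegion hρ (by linarith)
      (by exact_mod_cast h0) (by exact_mod_cast h1) (by linarith) hD hr, hr.2.1⟩
  have hsub0 : ∀ᶠ δ in 𝓝[>] (0 : I), binaryRegion D ρ δ ⊆ Set.Ici G ×ˢ Set.Ici 0 := by
    filter_upwards [self_mem_nhdsWithin,
      eventually_nhdsWithin_of_eventually_nhds (eventually_lt_nhds zero_lt_one)] with δ h0 h1
    exact hsub δ h0 h1
  have hsub1 : ∀ᶠ δ in 𝓝[<] (1 : I), binaryRegion D ρ δ ⊆ Set.Ici G ×ˢ Set.Ici 0 := by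
    filter_upwards [self_mem_nhdsWithin,
      eventually_nhdsWithin_of_eventually_nhds (eventually_gt_nhds zero_lt_one)] with δ h1 h0
    exact hsub δ h0 h1
  have hclosed : IsClosed (Set.Ici G ×ˢ Set.Ici (0 : ℝ)) := isClosed_Ici.prod isClosed_Ici
  have hdense : Set.Ici G ×ˢ Set.Ici (0 : ℝ) ⊆ closure (Set.Ioi G ×ˢ Set.Ici (0 : ℝ)) := by
    rw [closure_prod_eq, closure_Ioi, closure_Ici]
  have hmem0 : ∀ r ∈ Set.Ioi G ×ˢ Set.Ici (0 : ℝ), ∀ᶠ δ in 𝓝[>] (0 : I), r ∈ binaryRegion D ρ δ :=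
    fun r hr => eventually_nhdsWithin_of_eventually_nhds
      (eventually_mem_binaryRegion hρ hρD hD hr.1 hr.2)
  have hval0 : binaryRegion D ρ 0 = Set.Ici 0 ×ˢ Set.Ici 0 := binaryRegion_zero hρD.le
  have hval1 : binaryRegion D ρ 1 = Set.Ici 0 ×ˢ Set.Ici 0 := by
    rw [← hval0, ← binaryRegion_symm, unitInterval.symm_one]
  have horigin : (0 : ℝ × ℝ) ∈ Set.Ici (0 : ℝ) ×ˢ Set.Ici (0 : ℝ) :=
    ⟨Set.self_mem_Ici, Set.self_mem_Ici⟩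
  have hne : Set.Ici G ×ˢ Set.Ici (0 : ℝ) ≠ Set.Ici 0 ×ˢ Set.Ici 0 := fun h =>
    not_le.2 hG (Set.mem_Ici.1 (h ▸ horigin : (0 : ℝ × ℝ) ∈ Set.Ici G ×ˢ Set.Ici (0 : ℝ)).1)
  refine ⟨setTendsto_of_subset_of_dense hclosed hsub0 hdense hmem0,
    setTendsto_of_subset_of_dense hclosed hsub1 hdense fun r hr => ?_, hval0, hval1,
    hval0 ▸ hne, hval1 ▸ hne,
    not_setTendsto_binarySource nhdsWithin_le_nhds hG (hval0 ▸ horigin) hsub0,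
    not_setTendsto_binarySource nhdsWithin_le_nhds hG (hval1 ▸ horigin) hsub1⟩
  filter_upwards [tendsto_symm_nhdsLT_one.eventually (hmem0 r hr)] with δ hδ
  rwa [binaryRegion_symm] at hδ
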